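/- Let $p$ be the number of nodes and, for $\theta=(\beta_{1,0},\dots,\beta_{p,0},\beta_{1,1},\dots,\beta_{p,1})\in\mathbb R^{2p}$, put $\alpha_{r,i,j}=e^{\beta_{i,r}+\beta_{j,r}}$ ($r=0,1$). Write $\{\mathbf X^t\}_{t\ge 0}\sim P_\theta$ if $\mathbf X^t=(X^t_{i,j})$ are symmetric $0/1$ matrices with zero diagonal such that for $i<j$ and $t\ge 1$ $$X^t_{i,j}=I(\varepsilon^t_{i,j}=0)+X^{t-1}_{i,j}I(\varepsilon^t_{i,j}=1),$$ where $$P(\varepsilon^t_{i,j}=r)=\frac{\alpha_{r,i,j}}{1+\alpha_{0,i,j}+\alpha_{1,i,j}}\ (r=0,1),\qquad P(\varepsilon^t_{i,j}=-1)=\frac{1}{1+\alpha_{0,i,j}+\alpha_{1,i,j}},$$ the initial entries satisfy $P(X^0_{i,j}=1)=\alpha_{0,i,j}/(1+\alpha_{0,i,j})$, and all $X^0_{i,j}$ and $\varepsilon^t_{i,j}$ ($i<j$, $t\ge1$) are independent. Let $$l(\theta)=-\frac1{np}\log\prod_{t=1}^n\prod_{i<j}P_\theta\big(X^t_{i,j}\mid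 X^{t-1}_{i,j}\big)$$ be the normalized negative log-likelihood of $\mathbf X^1,\dots,\mathbf X^n$ given $\mathbf X^0$, and $\mathbf V(\theta)=\partial^2 l(\theta)/\partial\theta\,\partial\theta^\top$ its Hessian. Put $\mathbf B_\infty(\theta^*,r)=\{\theta:\|\theta-\theta^*\|_\infty\le r\}$ and, for a constant $C_\kappa>0$, $$\mathbf B'(\kappa_0,\kappa_1)=\{\theta:\ -\kappa_0\le\beta_{i,0}\le C_\kappa,\ |\beta_{i,1}|\le\kappa_1\ \text{ for } i=1,\dots,p\}.$$ Let $K$ be a constant. Condition (A1) on the true parameter $\theta^*$ is: $\beta^*_{i,1}-\max(\beta^*_{i,0},0)<K$ for all $i$. An MLE in a set $B$ is a point of $B$ at which $l$ attains its minimum over $B$. There exist $c_0>0$ and $C>0$, depending only on $K$ and $C_\kappa$, such that for every $c_r\in(0,c_0]$ the following hold with $r=c_re^{-2\kappa_0-4\kappa_1}$. 1. For all $n\ge1$, $p\ge3$, $\kappa_0,\kappa_1\in\mathbb R$ and all $\theta^*$ satisfying (A1), if $\{\mathbf X^t\}\sim P_{\theta^*}$, then for all $\theta\in\mathbf B_\infty(\theta^*,r)\cap\mathbf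 B'(\kappa_0,\kappa_1)$ and all $\mathbf a\in\mathbb R^{2p}$ with $\|\mathbf a\|_2=1$, $$\mathbf a^\top\,\mathbb E(\mathbf V(\theta))\,\mathbf a\ \ge\ C\,e^{-2\kappa_0-4\kappa_1}.$$ 2. Let $0<c<1/6$. As $np\to\infty$ with $n\ge2$ and $p\ge3$, the probability that there is a unique MLE in $\mathbf B_\infty(\theta^*,r)$ tends to $1$, uniformly over all $\kappa_0,\kappa_1$ with $\kappa_0+2\kappa_1<c\log(np)$, all $\theta^*\in\mathbf B'(\kappa_0,\kappa_1)$ satisfying (A1), and all $\{\mathbf X^t\}\sim P_{\theta^*}$. -/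

import Mathlib

open MeasureTheory ProbabilityTheory

noncomputable section

namespace TWHM

/-- Parameters `θ = (β₀, β₁)` of a network on `p` nodes, with the `ℓ_∞` norm of a function space:
`θ (Sum.inl i)` is `β_{i,0}` and `θ (Sum.inr i)` is `β_{i,1}`. -/
abbrev Param (p : ℕ) : Type := Fin p ⊕ Fin p → ℝ

/-- `β_{i,0}`, the static heterogeneity parameter of node `i`. -/
def beta0 {p : ℕ} (θ : Param p) (i : Fin p) : ℝ := θ (Sum.inl i)

/-- `β_{i,1}`, the dynamic heterogeneity parameter of node `i`. -/
def beta1 {p : ℕ} (θ : Param p) (i : Fin p) : ℝ := θ (Sum.inr i)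

/-- `α_{0,i,j} = exp (β_{i,0} + β_{j,0})`. -/
def alpha0 {p : ℕ} (θ : Param p) (i j : Fin p) : ℝ := Real.exp (beta0 θ i + beta0 θ j)

/-- `α_{1,i,j} = exp (β_{i,1} + β_{j,1})`. -/
def alpha1 {p : ℕ} (θ : Param p) (i j : Fin p) : ℝ := Real.exp (beta1 θ i + beta1 θ j)

/-- The set `𝒥` of pairs `(i, j)` with `i < j`. -/
def pairs (p : ℕ) : Finset (Fin p × Fin p) := Finset.univ.filter fun e => e.1 < e.2

/-- The stationary two-way heterogeneity model with parameter `θ`: `X t i j` is the `(i, j)` entry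
of the adjacency matrix at time `t`, and `ε t i j` (used for `t ≥ 1` and `i < j`) the innovation. -/
structure IsModelWith {p : ℕ} (θ : Param p) {Ω : Type*} [MeasurableSpace Ω] (P : Measure Ω)
    (X ε : ℕ → Fin p → Fin p → Ω → ℤ) : Prop where
  zero_or_one : ∀ t i j ω, X t i j ω = 0 ∨ X t i j ω = 1
  symm : ∀ t i j ω, X t i j ω = X t j i ω
  no_loop : ∀ t i ω, X t i i ω = 0
  measurable_init : ∀ i j, Measurable (X 0 i j)
  measurable_innov : ∀ t i j, Measurable (ε t i j)
  /-- `X^t = 1{ε^t = 0} + X^{t-1} 1{ε^t = 1}`. -/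
  step : ∀ t i j ω, i < j →
    X (t + 1) i j ω =
      (if ε (t + 1) i j ω = 0 then 1 else 0) + X t i j ω * (if ε (t + 1) i j ω = 1 then 1 else 0)
  /-- All the initial entries and all the innovations are jointly independent. -/
  indep : iIndepFun
    (fun (q : {e : Fin p × Fin p // e.1 < e.2} × ℕ) (ω : Ω) =>
      if q.2 = 0 then X 0 q.1.1.1 q.1.1.2 ω else ε q.2 q.1.1.1 q.1.1.2 ω) P
  innov_zero : ∀ t i j, i < j → 1 ≤ t →
    P.real {ω | ε t i j ω = 0} = alpha0 θ i j / (1 + alpha0 θ i j + alpha1 θ i j)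
  innov_one : ∀ t i j, i < j → 1 ≤ t →
    P.real {ω | ε t i j ω = 1} = alpha1 θ i j / (1 + alpha0 θ i j + alpha1 θ i j)
  innov_neg_one : ∀ t i j, i < j → 1 ≤ t →
    P.real {ω | ε t i j ω = -1} = 1 / (1 + alpha0 θ i j + alpha1 θ i j)
  /-- The process starts from its stationary distribution. -/
  init_one : ∀ i j, i < j → P.real {ω | X 0 i j ω = 1} = alpha0 θ i j / (1 + alpha0 θ i j)

/-- `{X^t} ∼ P_θ`: the process `X` follows the stationary model with parameter `θ`. -/
def IsModel {p : ℕ} (θ : Param p) {Ω : Type*} [MeasurableSpace Ω] (P : Measure Ω)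
    (X : ℕ → Fin p → Fin p → Ω → ℤ) : Prop :=
  ∃ ε : ℕ → Fin p → Fin p → Ω → ℤ, IsModelWith θ P X ε

/-- The one-step transition probability of an edge from state `x` to state `y` (`x, y ∈ {0, 1}`),
as a function of `a₀ = α_{0,i,j}` and `a₁ = α_{1,i,j}`. -/
def stepProb (a₀ a₁ : ℝ) (x y : ℤ) : ℝ :=
  if x = 0 then
    if y = 0 then (1 + a₁) / (1 + a₀ + a₁) else a₀ / (1 + a₀ + a₁)
  else
    if y = 0 then 1 / (1 + a₀ + a₁) else (a₀ + a₁) / (1 + a₀ + a₁)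

/-- The likelihood of `x 1, …, x n` conditionally on `x 0`. -/
def condLikelihood {p : ℕ} (n : ℕ) (x : ℕ → Fin p → Fin p → ℤ) (θ : Param p) : ℝ :=
  ∏ t ∈ Finset.range n, ∏ e ∈ pairs p,
    stepProb (alpha0 θ e.1 e.2) (alpha1 θ e.1 e.2) (x t e.1 e.2) (x (t + 1) e.1 e.2)

/-- The normalized negative log-likelihood `l(θ)`. -/
def negLogLik {p : ℕ} (n : ℕ) (x : ℕ → Fin p → Fin p → ℤ) (θ : Param p) : ℝ :=
  -(1 / ((n : ℝ) * (p : ℝ))) * Real.log (condLikelihood n x θ)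

/-- The matrix of second-order partial derivatives of `f` at `x`. -/
def hessian {ι : Type*} [Fintype ι] [DecidableEq ι] (f : (ι → ℝ) → ℝ) (x : ι → ℝ) :
    Matrix ι ι ℝ :=
  Matrix.of fun a b =>
    fderiv ℝ (fun y => fderiv ℝ f y (Pi.single b 1)) x (Pi.single a 1)

/-- The Hessian matrix `V(θ)` of the normalized negative log-likelihood. -/
def V {p : ℕ} (n : ℕ) (x : ℕ → Fin p → Fin p → ℤ) (θ : Param p) :
    Matrix (Fin p ⊕ Fin p) (Fin p ⊕ Fin p) ℝ :=
  hessian (negLogLik n x) θ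

/-- The entrywise expectation `E V(θ)`. -/
def expV {p : ℕ} (n : ℕ) {Ω : Type*} [MeasurableSpace Ω] (P : Measure Ω)
    (X : ℕ → Fin p → Fin p → Ω → ℤ) (θ : Param p) :
    Matrix (Fin p ⊕ Fin p) (Fin p ⊕ Fin p) ℝ :=
  Matrix.of fun a b => ∫ ω, V n (fun t i j => X t i j ω) θ a b ∂P

/-- Condition (A1) with constant `K`. -/
def CondA1 {p : ℕ} (K : ℝ) (θ : Param p) : Prop :=
  ∀ i, beta1 θ i - max (beta0 θ i) 0 < K

/-- The set `B'(κ₀, κ₁)` of parameters of the sparse regime, with upper bound `Cκ` on `β₀`. -/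
def sparseSet (p : ℕ) (Cκ κ₀ κ₁ : ℝ) : Set (Param p) :=
  {θ | ∀ i, (-κ₀ ≤ beta0 θ i ∧ beta0 θ i ≤ Cκ) ∧ |beta1 θ i| ≤ κ₁}

/-- The closed `ℓ_∞` ball `B_∞(θ, r)`. -/
def ballInf {p : ℕ} (θ : Param p) (r : ℝ) : Set (Param p) := {η | ‖η - θ‖ ≤ r}

/-- `θ` is a (local) MLE in the set `B`: it lies in `B` and minimizes the negative log-likelihood
over `B`. -/
def IsMLEIn {p : ℕ} (n : ℕ) (x : ℕ → Fin p → Fin p → ℤ) (B : Set (Param p)) (θ : Param p) : Prop :=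
  θ ∈ B ∧ IsMinOn (negLogLik n x) B θ

end TWHM

end

noncomputable section

namespace TWHM

/-! The likelihood splits over pairs: up to the factor `1/p`, `l(θ)` is a sum over `i < j` of a
function of `u = β_{i,0} + β_{j,0}` and `v = β_{i,1} + β_{j,1}` whose coefficients are the
transition frequencies of the pair. This function need not be convex, because `A log(1 + e^v)` and
`B log(e^u + e^v)` enter with a minus sign. When `A` and `B` are the stationary probabilities at the
same `(u, v)`, however, its Hessian is a sum of three squares with positive coefficients
(`edgeHess_stat`), and on the sparse set it is at least a constant times `e^{-2κ₀-4κ₁}`. Summation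
over pairs multiplies this by at least `p - 2` (`le_sum_pairs_sq`).

If the frequencies are stationary at `θ*` but the Hessian is taken at `θ`, the error is at most an
absolute constant times `‖θ - θ*‖_∞`, so a radius that is a small multiple of the curvature is
harmless (`edgeHess_ge`, `totalHess_ge`). The Hessian is affine in the frequencies, hence its
expectation is exactly this case, which gives the eigenvalue bound.

For the MLE there remains the random part, a quadratic form `∑ ξ_{ij} (w_i + w_j)²` with independent
centred `ξ_{ij}`. It involves the data and `θ*` only, so uniformity in `θ` costs nothing. A
martingale decomposition shows each `ξ_{ij}` to be sub-Gaussian with variance proxy of order `1/n`;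
here (A1) and `β_{i,0} ≤ Cκ` bound the coefficients. A union bound over integer points
(`exists_bad_set`) bounds the form by `3τp‖w‖²`, with `τ` of order `(np)^{-2c}`, just below the
curvature. The failure probability is governed by `exp(-g (np)^{1-4c})`, and `1 - 4c > 1/3` since `c
< 1/6`. Off the bad event the loss is strictly convex on the compact ball, so its minimizer there
exists and is unique. -/

/-- The sum `β_{i,0} + β_{j,0}` over the pair `e = (i, j)`. -/
def pairSum0 {p : ℕ} (θ : Param p) (e : Fin p × Fin p) : ℝ := beta0 θ e.1 + beta0 θ e.2

/-- The sum `β_{i,1} + β_{j,1}` over the pair `e = (i, j)`. -/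
def pairSum1 {p : ℕ} (θ : Param p) (e : Fin p × Fin p) : ℝ := beta1 θ e.1 + beta1 θ e.2

/-! ### The loss of a single pair and its derivatives -/

/-- Empirical frequency of `0 → 0` transitions of a `0/1` sequence. -/
def freq00 (n : ℕ) (x : ℕ → ℤ) : ℝ :=
  (∑ t ∈ Finset.range n, (1 - (x t : ℝ)) * (1 - (x (t + 1) : ℝ))) / n

/-- Empirical frequency of `1 → 1` transitions of a `0/1` sequence. -/
def freq11 (n : ℕ) (x : ℕ → ℤ) : ℝ :=
  (∑ t ∈ Finset.range n, (x t : ℝ) * (x (t + 1) : ℝ)) / n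

/-- Empirical frequency of `0 → 1` transitions of a `0/1` sequence. -/
def freq01 (n : ℕ) (x : ℕ → ℤ) : ℝ :=
  (∑ t ∈ Finset.range n, (1 - (x t : ℝ)) * (x (t + 1) : ℝ)) / n

/-- The contribution of one pair to the negative log-likelihood, where `A`, `B`, `C` are the
frequencies of the transitions `0 → 0`, `1 → 1`, `0 → 1`. -/
def edgeLoss (A B C u v : ℝ) : ℝ :=
  Real.log (1 + Real.exp u + Real.exp v) - C * u - A * Real.log (1 + Real.exp v)
    - B * Real.log (Real.exp u + Real.exp v)

/-- The directional derivative of `edgeLoss` in the direction `(s, w)`. -/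
def edgeGrad (A B C u v s w : ℝ) : ℝ :=
  (Real.exp u * s + Real.exp v * w) / (1 + Real.exp u + Real.exp v) - C * s
    - A * (Real.exp v * w / (1 + Real.exp v))
    - B * ((Real.exp u * s + Real.exp v * w) / (Real.exp u + Real.exp v))

/-- The derivative of the logistic function, in the variable `v`. -/
def logisticDeriv (v : ℝ) : ℝ := Real.exp v / (1 + Real.exp v) ^ 2

/-- The derivative of the logistic function at `u - v`, written symmetrically. -/
def logisticDeriv2 (u v : ℝ) : ℝ := Real.exp u * Real.exp v / (Real.exp u + Real.exp v) ^ 2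

/-- The Hessian of `edgeLoss` as a bilinear form. -/
def edgeHess (A B u v s w s' w' : ℝ) : ℝ :=
  (Real.exp u * Real.exp v * ((s - w) * (s' - w')) + Real.exp u * (s * s')
      + Real.exp v * (w * w')) / (1 + Real.exp u + Real.exp v) ^ 2
    - A * (logisticDeriv v * (w * w')) - B * (logisticDeriv2 u v * ((s - w) * (s' - w')))

/-- The transition `1 → 0` has numerator `1`, so it contributes the normalizer only; this is why
three frequencies suffice. -/
lemma log_stepProb (u v : ℝ) {x y : ℤ} (hx : x = 0 ∨ x = 1) (hy : y = 0 ∨ y = 1) :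
    -Real.log (stepProb (Real.exp u) (Real.exp v) x y) =
      Real.log (1 + Real.exp u + Real.exp v) - ((1 - (x : ℝ)) * y) * u
        - ((1 - (x : ℝ)) * (1 - (y : ℝ))) * Real.log (1 + Real.exp v)
        - ((x : ℝ) * y) * Real.log (Real.exp u + Real.exp v) := by
  have hu := Real.exp_pos u
  have hv := Real.exp_pos v
  have hD : (1 + Real.exp u + Real.exp v) ≠ 0 := by positivity
  rcases hx with rfl | rfl <;> rcases hy with rfl | rfl <;> simp only [stepProb]
  · have h1 : (1 + Real.exp v) ≠ 0 := by positivity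
    simp [Real.log_div h1 hD]
  · simp [Real.log_div hu.ne' hD]
  · simp
  · have h1 : (Real.exp u + Real.exp v) ≠ 0 := by positivity
    simp [Real.log_div h1 hD]

lemma stepProb_pos {a₀ a₁ : ℝ} (h₀ : 0 < a₀) (h₁ : 0 < a₁) (x y : ℤ) :
    0 < stepProb a₀ a₁ x y := by
  unfold stepProb
  split_ifs <;> positivity

lemma negLogLik_eq {p n : ℕ} (hn : 1 ≤ n) {x : ℕ → Fin p → Fin p → ℤ}
    (hx : ∀ t i j, x t i j = 0 ∨ x t i j = 1) (θ : Param p) :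
    negLogLik n x θ = (1 / (p : ℝ)) * ∑ e ∈ pairs p,
      edgeLoss (freq00 n fun t => x t e.1 e.2) (freq11 n fun t => x t e.1 e.2)
        (freq01 n fun t => x t e.1 e.2) (pairSum0 θ e) (pairSum1 θ e) := by
  have hn' : (n : ℝ) ≠ 0 := by positivity
  have hpos : ∀ t (e : Fin p × Fin p), stepProb (alpha0 θ e.1 e.2) (alpha1 θ e.1 e.2)
      (x t e.1 e.2) (x (t + 1) e.1 e.2) ≠ 0 := fun t e =>
    (stepProb_pos (Real.exp_pos _) (Real.exp_pos _) _ _).ne'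
  rw [negLogLik, condLikelihood,
    Real.log_prod (fun t _ => Finset.prod_ne_zero_iff.2 fun e _ => hpos t e)]
  simp_rw [Real.log_prod (fun e (_ : e ∈ pairs p) => hpos _ e)]
  rw [Finset.sum_comm, neg_mul, ← mul_neg, ← Finset.sum_neg_distrib, one_div, mul_inv, mul_assoc,
    mul_left_comm, one_div]
  congr 1
  rw [Finset.mul_sum]
  refine Finset.sum_congr rfl fun e _ => ?_
  rw [← Finset.sum_neg_distrib]
  have : ∀ t, -Real.log (stepProb (alpha0 θ e.1 e.2) (alpha1 θ e.1 e.2)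
      (x t e.1 e.2) (x (t + 1) e.1 e.2)) = _ := fun t =>
    log_stepProb (pairSum0 θ e) (pairSum1 θ e) (hx t e.1 e.2) (hx (t + 1) e.1 e.2)
  simp_rw [this, Finset.sum_sub_distrib, ← Finset.sum_mul]
  simp only [edgeLoss, freq00, freq11, freq01, Finset.sum_const, Finset.card_range, nsmul_eq_mul]
  field_simp

lemma hasDerivAt_edgeLoss (A B C u v s w τ : ℝ) :
    HasDerivAt (fun τ => edgeLoss A B C (u + τ * s) (v + τ * w))
      (edgeGrad A B C (u + τ * s) (v + τ * w) s w) τ := by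
  have hu : HasDerivAt (fun τ => u + τ * s) s τ := by
    simpa using ((hasDerivAt_id τ).mul_const s).const_add u
  have hv : HasDerivAt (fun τ => v + τ * w) w τ := by
    simpa using ((hasDerivAt_id τ).mul_const w).const_add v
  have eu := hu.exp
  have ev := hv.exp
  have h1 := ((eu.const_add 1).fun_add ev).log (by positivity)
  have h2 := (ev.const_add 1).log (by positivity)
  have h3 := (eu.fun_add ev).log (by positivity)
  have := ((h1.fun_sub (hu.const_mul C)).fun_sub (h2.const_mul A)).fun_sub (h3.const_mul B)
  exact this

lemma hasDerivAt_edgeGrad (A B C u v s w s' w' τ : ℝ) :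
    HasDerivAt (fun τ => edgeGrad A B C (u + τ * s) (v + τ * w) s' w')
      (edgeHess A B (u + τ * s) (v + τ * w) s w s' w') τ := by
  have hu : HasDerivAt (fun τ => u + τ * s) s τ := by
    simpa using ((hasDerivAt_id τ).mul_const s).const_add u
  have hv : HasDerivAt (fun τ => v + τ * w) w τ := by
    simpa using ((hasDerivAt_id τ).mul_const w).const_add v
  have eu := hu.exp
  have ev := hv.exp
  have hN := (eu.mul_const s').fun_add (ev.mul_const w')
  have h1 := hN.fun_div ((eu.const_add 1).fun_add ev) (by positivity)
  have h2 := (ev.mul_const w').fun_div (ev.const_add 1) (by positivity)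
  have h3 := hN.fun_div (eu.fun_add ev) (by positivity)
  have := ((h1.fun_sub (hasDerivAt_const τ (C * s'))).fun_sub (h2.const_mul A)).fun_sub
    (h3.const_mul B)
  refine this.congr_deriv ?_
  simp only [edgeHess, logisticDeriv, logisticDeriv2]
  field_simp
  ring

/-! ### The total loss and its Hessian as a bilinear form -/

/-- The common form of the negative log-likelihood, with arbitrary transition frequencies. -/
def totalLoss {p : ℕ} (A B C : Fin p × Fin p → ℝ) (θ : Param p) : ℝ :=
  (1 / (p : ℝ)) * ∑ e ∈ pairs p, edgeLoss (A e) (B e) (C e) (pairSum0 θ e) (pairSum1 θ e)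

/-- The directional derivative of `totalLoss`. -/
def totalGrad {p : ℕ} (A B C : Fin p × Fin p → ℝ) (θ a : Param p) : ℝ :=
  (1 / (p : ℝ)) * ∑ e ∈ pairs p,
    edgeGrad (A e) (B e) (C e) (pairSum0 θ e) (pairSum1 θ e) (pairSum0 a e) (pairSum1 a e)

/-- The Hessian of `totalLoss` as a bilinear form. -/
def totalHess {p : ℕ} (A B : Fin p × Fin p → ℝ) (θ a b : Param p) : ℝ :=
  (1 / (p : ℝ)) * ∑ e ∈ pairs p,
    edgeHess (A e) (B e) (pairSum0 θ e) (pairSum1 θ e) (pairSum0 a e) (pairSum1 a e)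
      (pairSum0 b e) (pairSum1 b e)

section deriv
variable {p : ℕ} (A B C : Fin p × Fin p → ℝ)

lemma pairSum0_add_smul (θ a : Param p) (τ : ℝ) (e : Fin p × Fin p) :
    pairSum0 (θ + τ • a) e = pairSum0 θ e + τ * pairSum0 a e := by
  simp [pairSum0, beta0]; ring

lemma pairSum1_add_smul (θ a : Param p) (τ : ℝ) (e : Fin p × Fin p) :
    pairSum1 (θ + τ • a) e = pairSum1 θ e + τ * pairSum1 a e := by
  simp [pairSum1, beta1]; ring

lemma hasDerivAt_totalLoss (θ a : Param p) (τ : ℝ) :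
    HasDerivAt (fun τ : ℝ => totalLoss A B C (θ + τ • a)) (totalGrad A B C (θ + τ • a) a) τ := by
  simp only [totalLoss, totalGrad, pairSum0_add_smul, pairSum1_add_smul]
  exact (HasDerivAt.fun_sum fun e _ => hasDerivAt_edgeLoss _ _ _ _ _ _ _ _).const_mul _

lemma hasDerivAt_totalGrad (θ a b : Param p) (τ : ℝ) :
    HasDerivAt (fun τ : ℝ => totalGrad A B C (θ + τ • a) b) (totalHess A B (θ + τ • a) a b) τ := by
  simp only [totalHess, totalGrad, pairSum0_add_smul, pairSum1_add_smul]
  exact (HasDerivAt.fun_sum fun e _ => hasDerivAt_edgeGrad _ _ _ _ _ _ _ _ _ _).const_mul _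

lemma differentiable_pairSum0 (e : Fin p × Fin p) :
    Differentiable ℝ fun θ : Param p => pairSum0 θ e := by
  unfold pairSum0 beta0; fun_prop

lemma differentiable_pairSum1 (e : Fin p × Fin p) :
    Differentiable ℝ fun θ : Param p => pairSum1 θ e := by
  unfold pairSum1 beta1; fun_prop

lemma differentiable_totalLoss : Differentiable ℝ (totalLoss A B C) := by
  unfold totalLoss
  refine (Differentiable.fun_sum fun e _ => ?_).const_mul _
  have h0 := differentiable_pairSum0 e
  have h1 := differentiable_pairSum1 e
  unfold edgeLoss
  have e1 := (((h0.exp).const_add 1).fun_add h1.exp).log (fun θ => by positivity)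
  have e2 := ((h1.exp).const_add 1).log (fun θ => by positivity)
  have e3 := ((h0.exp).fun_add h1.exp).log (fun θ => by positivity)
  exact ((e1.fun_sub (h0.const_mul _)).fun_sub (e2.const_mul _)).fun_sub (e3.const_mul _)

lemma differentiable_totalGrad (a : Param p) : Differentiable ℝ fun θ => totalGrad A B C θ a := by
  unfold totalGrad
  refine (Differentiable.fun_sum fun e _ => ?_).const_mul _
  have h0 := (differentiable_pairSum0 e).exp
  have h1 := (differentiable_pairSum1 e).exp
  unfold edgeGrad
  have hN := (h0.mul_const (pairSum0 a e)).fun_add (h1.mul_const (pairSum1 a e))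
  have e1 := hN.fun_mul (((h0.const_add 1).fun_add h1).fun_inv (fun θ => by positivity))
  have e2 := (h1.mul_const (pairSum1 a e)).fun_mul
    ((h1.const_add 1).fun_inv (fun θ => by positivity))
  have e3 := hN.fun_mul ((h0.fun_add h1).fun_inv (fun θ => by positivity))
  simp only [div_eq_mul_inv]
  exact ((e1.sub_const _).fun_sub (e2.const_mul _)).fun_sub (e3.const_mul _)

/-- Differentiability identifies the Fréchet derivative with the derivative along a line, which is
one-variable calculus pair by pair. -/
lemma fderiv_totalLoss (θ a : Param p) : fderiv ℝ (totalLoss A B C) θ a = totalGrad A B C θ a := by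
  rw [← ((differentiable_totalLoss A B C) θ).lineDeriv_eq_fderiv]
  have h := hasDerivAt_totalLoss A B C θ a 0
  rw [zero_smul, add_zero] at h
  exact h.deriv

lemma hessian_totalLoss (θ : Param p) (k l : Fin p ⊕ Fin p) :
    hessian (totalLoss A B C) θ k l = totalHess A B θ (Pi.single k 1) (Pi.single l 1) := by
  simp only [hessian, Matrix.of_apply, fderiv_totalLoss]
  rw [← ((differentiable_totalGrad A B C (Pi.single l 1)) θ).lineDeriv_eq_fderiv]
  have h := hasDerivAt_totalGrad A B C θ (Pi.single k 1) (Pi.single l 1) 0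
  rw [zero_smul, add_zero] at h
  exact h.deriv

lemma sum_mul_pairSum0_single (a : Param p) (e : Fin p × Fin p) :
    ∑ k, a k * pairSum0 (Pi.single k (1 : ℝ)) e = pairSum0 a e := by
  simp [pairSum0, beta0, mul_add, Finset.sum_add_distrib, Pi.single_apply]

lemma sum_mul_pairSum1_single (a : Param p) (e : Fin p × Fin p) :
    ∑ k, a k * pairSum1 (Pi.single k (1 : ℝ)) e = pairSum1 a e := by
  simp [pairSum1, beta1, mul_add, Finset.sum_add_distrib, Pi.single_apply]

/-- `totalHess` as a bilinear form in its last two arguments. -/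
lemma sum_sum_mul_totalHess (θ a : Param p) :
    ∑ k, ∑ l, a k * a l * totalHess A B θ (Pi.single k 1) (Pi.single l 1)
      = totalHess A B θ a a := by
  simp only [totalHess]
  have key : ∀ e : Fin p × Fin p, ∀ A B u v : ℝ,
      ∑ k, ∑ l, a k * a l * edgeHess A B u v (pairSum0 (Pi.single k (1 : ℝ)) e)
        (pairSum1 (Pi.single k (1 : ℝ)) e) (pairSum0 (Pi.single l (1 : ℝ)) e)
        (pairSum1 (Pi.single l (1 : ℝ)) e)
      = edgeHess A B u v (pairSum0 a e) (pairSum1 a e) (pairSum0 a e) (pairSum1 a e) := by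
    intro e A B u v
    have hprod : ∀ f g : (Fin p ⊕ Fin p) → ℝ, ∑ k, ∑ l, a k * a l * (f k * g l)
        = (∑ k, a k * f k) * ∑ l, a l * g l := by
      intro f g
      rw [Finset.sum_mul_sum]
      exact Finset.sum_congr rfl fun k _ => Finset.sum_congr rfl fun l _ => by ring
    set f0 : (Fin p ⊕ Fin p) → ℝ := fun k => pairSum0 (Pi.single k (1 : ℝ)) e with hf0
    set f1 : (Fin p ⊕ Fin p) → ℝ := fun k => pairSum1 (Pi.single k (1 : ℝ)) e with hf1
    have h00 := hprod f0 f0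
    have h01 := hprod f0 f1
    have h10 := hprod f1 f0
    have h11 := hprod f1 f1
    have s0 : ∑ k, a k * f0 k = pairSum0 a e := sum_mul_pairSum0_single a e
    have s1 : ∑ k, a k * f1 k = pairSum1 a e := sum_mul_pairSum1_single a e
    rw [s0] at h00 h01 h10
    rw [s1] at h01 h10 h11
    -- A bilinear form on the plane is recovered from its four values on basis vectors.
    have expand : ∀ k l, a k * a l * edgeHess A B u v (f0 k) (f1 k) (f0 l) (f1 l)
        = edgeHess A B u v 1 0 1 0 * (a k * a l * (f0 k * f0 l))
        + edgeHess A B u v 1 0 0 1 * (a k * a l * (f0 k * f1 l))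
        + edgeHess A B u v 0 1 1 0 * (a k * a l * (f1 k * f0 l))
        + edgeHess A B u v 0 1 0 1 * (a k * a l * (f1 k * f1 l)) := by
      intro k l
      simp only [edgeHess]
      ring
    change ∑ k, ∑ l, a k * a l * edgeHess A B u v (f0 k) (f1 k) (f0 l) (f1 l) = _
    simp_rw [expand, Finset.sum_add_distrib, ← Finset.mul_sum, h00, h01, h10, h11]
    simp only [edgeHess]
    ring
  simp_rw [← key]
  calc _ = ∑ k, ∑ l, ∑ e ∈ pairs p, (1 / (p : ℝ)) * (a k * a l *
        edgeHess (A e) (B e) (pairSum0 θ e) (pairSum1 θ e) (pairSum0 (Pi.single k (1 : ℝ)) e)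
        (pairSum1 (Pi.single k (1 : ℝ)) e) (pairSum0 (Pi.single l (1 : ℝ)) e)
        (pairSum1 (Pi.single l (1 : ℝ)) e)) := by
        refine Finset.sum_congr rfl fun k _ => Finset.sum_congr rfl fun l _ => ?_
        rw [Finset.mul_sum, Finset.mul_sum]
        exact Finset.sum_congr rfl fun e _ => by ring
    _ = _ := by
        simp_rw [Finset.sum_comm (s := Finset.univ) (t := pairs p), Finset.mul_sum]

end deriv

/-- The frequencies of a network sequence, pair by pair. -/
lemma negLogLik_eq_totalLoss {p n : ℕ} (hn : 1 ≤ n) {x : ℕ → Fin p → Fin p → ℤ}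
    (hx : ∀ t i j, x t i j = 0 ∨ x t i j = 1) :
    negLogLik n x = totalLoss (fun e => freq00 n fun t => x t e.1 e.2)
      (fun e => freq11 n fun t => x t e.1 e.2) (fun e => freq01 n fun t => x t e.1 e.2) :=
  funext fun θ => negLogLik_eq hn hx θ

lemma V_apply {p n : ℕ} (hn : 1 ≤ n) {x : ℕ → Fin p → Fin p → ℤ}
    (hx : ∀ t i j, x t i j = 0 ∨ x t i j = 1) (θ : Param p) (k l : Fin p ⊕ Fin p) :
    V n x θ k l = totalHess (fun e => freq00 n fun t => x t e.1 e.2)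
      (fun e => freq11 n fun t => x t e.1 e.2) θ (Pi.single k 1) (Pi.single l 1) := by
  rw [V, negLogLik_eq_totalLoss hn hx, hessian_totalLoss]

/-! ### Curvature at stationary frequencies -/

/-- The stationary probability of a transition `0 → 0`. -/
def stat00 (u v : ℝ) : ℝ :=
  (1 + Real.exp v) / ((1 + Real.exp u) * (1 + Real.exp u + Real.exp v))

/-- The stationary probability of a transition `1 → 1`. -/
def stat11 (u v : ℝ) : ℝ :=
  Real.exp u * (Real.exp u + Real.exp v) / ((1 + Real.exp u) * (1 + Real.exp u + Real.exp v))

/-- With frequencies matched to the parameter the Hessian is the Fisher information of one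
stationary transition given its starting state, so the negative terms must be absorbed; the explicit
squares make this quantitative. -/
lemma edgeHess_stat (u v s w : ℝ) :
    edgeHess (stat00 u v) (stat11 u v) u v s w s w =
      Real.exp u / (1 + Real.exp u + Real.exp v) ^ 2 * s ^ 2
      + Real.exp u * Real.exp v ^ 2 /
        ((1 + Real.exp u + Real.exp v) ^ 2 * (1 + Real.exp u) * (1 + Real.exp v)) * w ^ 2
      + Real.exp u * Real.exp v ^ 2 /
        ((1 + Real.exp u + Real.exp v) ^ 2 * (1 + Real.exp u) * (Real.exp u + Real.exp v))
        * (s - w) ^ 2 := by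
  have hu := Real.exp_pos u
  have hv := Real.exp_pos v
  simp only [edgeHess, stat00, stat11, logisticDeriv, logisticDeriv2]
  generalize Real.exp u = X at *
  generalize Real.exp v = Y at *
  field_simp
  ring

/-- Lower bound for the Hessian of one pair at stationary frequencies. -/
lemma edgeHess_stat_ge {u v M T : ℝ} (hu : Real.exp u ≤ M) (hT : 1 ≤ T)
    (hv1 : 1 / T ≤ Real.exp v) (hv2 : Real.exp v ≤ T) (s w : ℝ) :
    Real.exp u / (8 * (1 + M) ^ 3 * T ^ 2) * (s ^ 2 + w ^ 2) ≤
      edgeHess (stat00 u v) (stat11 u v) u v s w s w := by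
  rw [edgeHess_stat]
  have hX := Real.exp_pos u
  have hY := Real.exp_pos v
  generalize Real.exp u = X at *
  generalize Real.exp v = Y at *
  have hM : 0 < M := hX.trans_le hu
  have hT0 : 0 < T := by linarith
  have h1 : X / (8 * (1 + M) ^ 3 * T ^ 2) ≤ X / (1 + X + Y) ^ 2 := by
    apply div_le_div_of_nonneg_left hX.le (by positivity)
    have hD : 1 + X + Y ≤ 2 * (1 + M) * T := by nlinarith [mul_nonneg hM.le (sub_nonneg.2 hT)]
    calc (1 + X + Y) ^ 2 ≤ (2 * (1 + M) * T) ^ 2 := by gcongr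
      _ = 4 * (1 + M) ^ 2 * T ^ 2 := by ring
      _ ≤ 8 * (1 + M) ^ 3 * T ^ 2 := by
        have : 4 * (1 + M) ^ 2 ≤ 8 * (1 + M) ^ 3 := by
          nlinarith [sq_nonneg (1 + M), pow_pos (show 0 < 1 + M by linarith) 2]
        gcongr
  have hYT : 1 ≤ Y * T := by rwa [div_le_iff₀ hT0] at hv1
  -- For `Y ≤ 1` the left side is at most `8` and `YT ≥ 1`; for `Y ≥ 1` it is at most `8Y³` and `Y ≤
  -- T ≤ T²`.
  have hcube : (1 + Y) ^ 3 ≤ 8 * T ^ 2 * Y ^ 2 := by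
    rcases le_total Y 1 with h | h
    · have h8 : (1 + Y) ^ 3 ≤ (1 + 1) ^ 3 := by gcongr
      have h2 : 1 ≤ (Y * T) ^ 2 := one_le_pow₀ hYT
      nlinarith
    · have h8 : (1 + Y) ^ 3 ≤ (Y + Y) ^ 3 := by gcongr
      have h2 : Y ≤ T ^ 2 := hv2.trans (by nlinarith)
      nlinarith [mul_le_mul_of_nonneg_right h2 (sq_nonneg Y)]
  have h2 : X / (8 * (1 + M) ^ 3 * T ^ 2) ≤
      X * Y ^ 2 / ((1 + X + Y) ^ 2 * (1 + X) * (1 + Y)) := by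
    rw [div_le_div_iff₀ (by positivity) (by positivity)]
    have hD : 1 + X + Y ≤ (1 + M) * (1 + Y) := by nlinarith [mul_nonneg hM.le hY.le]
    calc X * ((1 + X + Y) ^ 2 * (1 + X) * (1 + Y))
        ≤ X * (((1 + M) * (1 + Y)) ^ 2 * (1 + M) * (1 + Y)) := by gcongr
      _ = X * (1 + M) ^ 3 * (1 + Y) ^ 3 := by ring
      _ ≤ X * (1 + M) ^ 3 * (8 * T ^ 2 * Y ^ 2) := by gcongr
      _ = _ := by ring
  have h3 : 0 ≤ X * Y ^ 2 / ((1 + X + Y) ^ 2 * (1 + X) * (X + Y)) * (s - w) ^ 2 := by positivity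
  nlinarith [mul_le_mul_of_nonneg_right h1 (sq_nonneg s),
    mul_le_mul_of_nonneg_right h2 (sq_nonneg w)]

/-! ### Stability of the Hessian under a change of parameter -/

/-- Two numbers agree up to a factor `e^δ`. -/
def Near (δ x y : ℝ) : Prop := x ≤ Real.exp δ * y ∧ y ≤ Real.exp δ * x

lemma near_exp {δ u u' : ℝ} (h : |u - u'| ≤ δ) : Near δ (Real.exp u) (Real.exp u') := by
  obtain ⟨h1, h2⟩ := abs_le.1 h
  constructor <;> rw [← Real.exp_add] <;> exact Real.exp_le_exp.2 (by linarith)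

lemma near_one {δ : ℝ} (h : 0 ≤ δ) : Near δ 1 1 := by
  have := Real.one_le_exp h
  constructor <;> linarith

lemma Near.add {δ x y x' y' : ℝ} (h : Near δ x x') (h' : Near δ y y') :
    Near δ (x + y) (x' + y') := by
  constructor
  · linarith [h.1, h'.1]
  · linarith [h.2, h'.2]

lemma Near.mul {δ δ' x y x' y' : ℝ} (h : Near δ x x') (h' : Near δ' y y') (hx : 0 < x)
    (hy : 0 < y) (hx' : 0 < x') (hy' : 0 < y') : Near (δ + δ') (x * y) (x' * y') := by
  rw [Near, Real.exp_add]
  constructor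
  · calc x * y ≤ (Real.exp δ * x') * (Real.exp δ' * y') := by gcongr; exacts [h.1, h'.1]
      _ = _ := by ring
  · calc x' * y' ≤ (Real.exp δ * x) * (Real.exp δ' * y) := by gcongr; exacts [h.2, h'.2]
      _ = _ := by ring

lemma Near.inv {δ x x' : ℝ} (h : Near δ x x') (hx : 0 < x) (hx' : 0 < x') :
    Near δ x⁻¹ x'⁻¹ := by
  constructor
  · rw [← div_eq_mul_inv, le_div_iff₀ hx', inv_mul_le_iff₀ hx, mul_comm]; exact h.2
  · rw [← div_eq_mul_inv, le_div_iff₀ hx, inv_mul_le_iff₀ hx', mul_comm]; exact h.1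

lemma Near.div {δ δ' x y x' y' : ℝ} (h : Near δ x x') (h' : Near δ' y y') (hx : 0 < x)
    (hy : 0 < y) (hx' : 0 < x') (hy' : 0 < y') : Near (δ + δ') (x / y) (x' / y') := by
  rw [div_eq_mul_inv, div_eq_mul_inv]
  exact h.mul (h'.inv hy hy') hx (inv_pos.2 hy) hx' (inv_pos.2 hy')

/-- Turns multiplicative into additive closeness for numbers in `[0, 1]`, through `e^δ - 1 ≤ 2δ` for
`δ ≤ 1`. -/
lemma Near.abs_sub_le {δ δ' x y : ℝ} (h : Near δ x y) (hδ : δ ≤ δ') (hδ' : δ' ≤ 1)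
    (h0 : 0 ≤ δ) (hx0 : 0 ≤ x) (hx : x ≤ 1) (hy0 : 0 ≤ y) (hy : y ≤ 1) :
    |x - y| ≤ 2 * δ' := by
  have he : Real.exp δ - 1 ≤ 2 * δ := by
    have := Real.abs_exp_sub_one_le (x := δ) (by rw [abs_of_nonneg h0]; linarith)
    rw [abs_of_nonneg h0] at this
    exact (le_abs_self _).trans this
  have h1 := Real.one_le_exp h0
  rw [abs_le]
  constructor
  · nlinarith [h.2]
  · nlinarith [h.1]

lemma logisticDeriv_nonneg (v : ℝ) : 0 ≤ logisticDeriv v := by unfold logisticDeriv; positivity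

lemma logisticDeriv_le_one (v : ℝ) : logisticDeriv v ≤ 1 := by
  unfold logisticDeriv
  have := Real.exp_pos v
  rw [div_le_one (by positivity)]
  nlinarith

lemma logisticDeriv2_nonneg (u v : ℝ) : 0 ≤ logisticDeriv2 u v := by
  unfold logisticDeriv2; positivity

lemma logisticDeriv2_le_one (u v : ℝ) : logisticDeriv2 u v ≤ 1 := by
  unfold logisticDeriv2
  have := Real.exp_pos v
  have := Real.exp_pos u
  rw [div_le_one (by positivity)]
  nlinarith

lemma stat00_nonneg (u v : ℝ) : 0 ≤ stat00 u v := by unfold stat00; positivity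

lemma stat00_le_one (u v : ℝ) : stat00 u v ≤ 1 := by
  unfold stat00
  have := Real.exp_pos v
  have := Real.exp_pos u
  rw [div_le_one (by positivity)]
  nlinarith [mul_pos (Real.exp_pos v) (Real.exp_pos u)]

lemma stat11_nonneg (u v : ℝ) : 0 ≤ stat11 u v := by unfold stat11; positivity

lemma stat11_le_one (u v : ℝ) : stat11 u v ≤ 1 := by
  unfold stat11
  have := Real.exp_pos v
  have := Real.exp_pos u
  rw [div_le_one (by positivity)]
  nlinarith [mul_pos (Real.exp_pos v) (Real.exp_pos u)]

/-- The quotient is built from sums of `1`, `e^u`, `e^v`. Each such sum changes by a factor of at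
most `e^η`, and no more than four of them occur in this or in the next three quotients, whence `4η`
throughout. -/
lemma abs_stat00_sub_le {η u v u' v' : ℝ} (hu : |u - u'| ≤ η) (hv : |v - v'| ≤ η)
    (hη : 4 * η ≤ 1) :
    |stat00 u v - stat00 u' v'| ≤ 8 * η := by
  have h0 : 0 ≤ η := (abs_nonneg _).trans hu
  have hU := near_exp hu
  have hV := near_exp hv
  have h1 := near_one h0
  have h := ((h1.add hV).div (((h1.add hU)).mul ((h1.add hU).add hV) (by positivity)
    (by positivity) (by positivity) (by positivity)) (by positivity) (by positivity)
    (by positivity) (by positivity))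
  have := Near.abs_sub_le (x := stat00 u v) (y := stat00 u' v') h (δ' := 4 * η) (by linarith) hη
    (by linarith) (stat00_nonneg _ _) (stat00_le_one _ _) (stat00_nonneg _ _) (stat00_le_one _ _)
  linarith

lemma abs_stat11_sub_le {η u v u' v' : ℝ} (hu : |u - u'| ≤ η) (hv : |v - v'| ≤ η)
    (hη : 4 * η ≤ 1) :
    |stat11 u v - stat11 u' v'| ≤ 8 * η := by
  have h0 : 0 ≤ η := (abs_nonneg _).trans hu
  have hU := near_exp hu
  have hV := near_exp hv
  have h1 := near_one h0
  have h := ((hU.mul (hU.add hV) (by positivity) (by positivity) (by positivity)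
    (by positivity)).div (((h1.add hU)).mul ((h1.add hU).add hV) (by positivity)
    (by positivity) (by positivity) (by positivity)) (by positivity) (by positivity)
    (by positivity) (by positivity))
  have := Near.abs_sub_le (x := stat11 u v) (y := stat11 u' v') h (δ' := 4 * η) (by linarith) hη
    (by linarith) (stat11_nonneg _ _) (stat11_le_one _ _) (stat11_nonneg _ _) (stat11_le_one _ _)
  linarith

lemma abs_logisticDeriv2_sub_le {η u v u' v' : ℝ} (hu : |u - u'| ≤ η) (hv : |v - v'| ≤ η)
    (hη : 4 * η ≤ 1) :
    |logisticDeriv2 u v - logisticDeriv2 u' v'| ≤ 8 * η := by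
  have h0 : 0 ≤ η := (abs_nonneg _).trans hu
  have hU := near_exp hu
  have hV := near_exp hv
  have h2 := (hU.add hV).mul (hU.add hV) (by positivity) (by positivity) (by positivity)
    (by positivity)
  rw [← pow_two, ← pow_two] at h2
  have h := ((hU.mul hV (by positivity) (by positivity) (by positivity)
    (by positivity)).div h2 (by positivity) (by positivity)
    (by positivity) (by positivity))
  have := Near.abs_sub_le (x := logisticDeriv2 u v) (y := logisticDeriv2 u' v') h (δ' := 4 * η)
    (by linarith) hη (by linarith) (logisticDeriv2_nonneg _ _) (logisticDeriv2_le_one _ _)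
    (logisticDeriv2_nonneg _ _) (logisticDeriv2_le_one _ _)
  linarith

lemma abs_logisticDeriv_sub_le {η v v' : ℝ} (hv : |v - v'| ≤ η) (hη : 4 * η ≤ 1) :
    |logisticDeriv v - logisticDeriv v'| ≤ 8 * η := by
  have h0 : 0 ≤ η := (abs_nonneg _).trans hv
  have hV := near_exp hv
  have h1 := near_one h0
  have h2 := (h1.add hV).mul (h1.add hV) (by positivity) (by positivity) (by positivity)
    (by positivity)
  rw [← pow_two, ← pow_two] at h2
  have h := (hV.div h2 (by positivity) (by positivity) (by positivity) (by positivity))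
  have := Near.abs_sub_le (x := logisticDeriv v) (y := logisticDeriv v') h (δ' := 4 * η)
    (by linarith) hη (by linarith) (logisticDeriv_nonneg _) (logisticDeriv_le_one _)
    (logisticDeriv_nonneg _) (logisticDeriv_le_one _)
  linarith

/-- Expand `A x = a x + (b' - a) x + (A - b') (x - x') + (A - b') x'`. The fluctuation `A - b'` is
left with the weight `x'` at the true parameter, so the random term does not depend on the point
where the Hessian is taken. -/
lemma mul_sub_mul_le {a b' x x' A η : ℝ} (hA0 : 0 ≤ A) (hA : A ≤ 1) (hb0 : 0 ≤ b')
    (hb : b' ≤ 1) (hx0 : 0 ≤ x) (hx : x ≤ 1) (h1 : |a - b'| ≤ η) (h2 : |x - x'| ≤ η) :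
    A * x ≤ a * x + 2 * η + (A - b') * x' := by
  have hAb : |A - b'| ≤ 1 := abs_le.2 ⟨by linarith, by linarith⟩
  have e1 : (b' - a) * x ≤ η := by
    have := neg_le_of_abs_le h1
    have hη : 0 ≤ η := (abs_nonneg _).trans h1
    nlinarith
  have e2 : (A - b') * (x - x') ≤ η := by
    calc (A - b') * (x - x') ≤ |(A - b') * (x - x')| := le_abs_self _
      _ = |A - b'| * |x - x'| := abs_mul _ _
      _ ≤ 1 * η := by gcongr
      _ = η := one_mul _
  nlinarith

/-- The Hessian of one pair at perturbed parameters and random frequencies: it is at least the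
stationary Hessian, up to the fluctuation of the frequencies and a multiple of the perturbation. -/
lemma edgeHess_ge {η u v u' v' A B : ℝ} (hu : |u - u'| ≤ η) (hv : |v - v'| ≤ η)
    (hη : 4 * η ≤ 1) (hA0 : 0 ≤ A) (hA : A ≤ 1) (hB0 : 0 ≤ B) (hB : B ≤ 1) (s w : ℝ) :
    edgeHess (stat00 u v) (stat11 u v) u v s w s w - 48 * η * (s ^ 2 + w ^ 2)
      - (A - stat00 u' v') * logisticDeriv v' * w ^ 2
      - (B - stat11 u' v') * logisticDeriv2 u' v' * (s - w) ^ 2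
      ≤ edgeHess A B u v s w s w := by
  have h0 : 0 ≤ η := (abs_nonneg _).trans hu
  have e1 := mul_sub_mul_le hA0 hA (stat00_nonneg u' v') (stat00_le_one u' v')
    (logisticDeriv_nonneg v) (logisticDeriv_le_one v) (abs_stat00_sub_le hu hv hη)
    (abs_logisticDeriv_sub_le hv hη)
  have e2 := mul_sub_mul_le hB0 hB (stat11_nonneg u' v') (stat11_le_one u' v')
    (logisticDeriv2_nonneg u v) (logisticDeriv2_le_one u v) (abs_stat11_sub_le hu hv hη)
    (abs_logisticDeriv2_sub_le hu hv hη)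
  have f1 := mul_le_mul_of_nonneg_right e1 (sq_nonneg w)
  have f2 := mul_le_mul_of_nonneg_right e2 (sq_nonneg (s - w))
  -- The error is `2 · 8η` on `w²` and `2 · 8η` on `(s - w)² ≤ 2(s² + w²)`, so `16 + 32 = 48`.
  have f3 : η * (s - w) ^ 2 ≤ η * (2 * (s ^ 2 + w ^ 2)) := by
    gcongr; nlinarith [sq_nonneg (s + w)]
  have f4 : 0 ≤ η * s ^ 2 := by positivity
  simp only [edgeHess]
  nlinarith

/-! ### From pairs to nodes -/

lemma two_mul_sum_pairs {p : ℕ} (g : Fin p → Fin p → ℝ) (hg : ∀ i j, g i j = g j i) :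
    2 * ∑ e ∈ pairs p, g e.1 e.2 = ∑ i, ∑ j, g i j - ∑ i, g i i := by
  have h1 : ∑ e ∈ pairs p, g e.1 e.2 = ∑ i, ∑ j, if i < j then g i j else 0 := by
    rw [pairs, Finset.sum_filter, ← Finset.univ_product_univ, Finset.sum_product]
  have h2 : ∑ e ∈ pairs p, g e.1 e.2 = ∑ i, ∑ j, if j < i then g i j else 0 := by
    rw [h1, Finset.sum_comm]
    exact Finset.sum_congr rfl fun i _ => Finset.sum_congr rfl fun j _ => by rw [hg]
  have h3 : ∑ i, g i i = ∑ i, ∑ j, if i = j then g i j else 0 := by simp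
  rw [two_mul, h3]
  nth_rw 1 [h1]
  rw [h2, ← Finset.sum_add_distrib, ← Finset.sum_sub_distrib]
  refine Finset.sum_congr rfl fun i _ => ?_
  rw [← Finset.sum_add_distrib, ← Finset.sum_sub_distrib]
  refine Finset.sum_congr rfl fun j _ => ?_
  rcases lt_trichotomy i j with h | h | h
  · simp [h, h.not_gt, h.ne]
  · simp [h]
  · simp [h, h.not_gt, h.ne']

/-- The right side equals `(p - 2) ∑ f_i² + (∑ f_i)²`; this is the signless Laplacian of the
complete graph. -/
lemma le_sum_pairs_sq {p : ℕ} (f : Fin p → ℝ) :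
    ((p : ℝ) - 2) * ∑ i, f i ^ 2 ≤ ∑ e ∈ pairs p, (f e.1 + f e.2) ^ 2 := by
  have h := two_mul_sum_pairs (fun i j => (f i + f j) ^ 2) (fun i j => by ring)
  have h2 : ∑ i, ∑ j, (f i + f j) ^ 2 = 2 * p * ∑ i, f i ^ 2 + 2 * (∑ i, f i) ^ 2 := by
    simp_rw [add_sq, Finset.sum_add_distrib, Finset.sum_const, ← Finset.mul_sum, ← Finset.sum_mul]
    simp only [Finset.card_univ, Fintype.card_fin, nsmul_eq_mul, ← Finset.mul_sum]
    ring
  have h3 : ∑ i, (f i + f i) ^ 2 = 4 * ∑ i, f i ^ 2 := by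
    rw [Finset.mul_sum]; exact Finset.sum_congr rfl fun i _ => by ring
  beta_reduce at h
  rw [h2, h3] at h
  nlinarith [sq_nonneg (∑ i, f i)]

lemma abs_pairSum0_sub_le {p : ℕ} {θ θ' : Param p} {r : ℝ} (h : ‖θ - θ'‖ ≤ r)
    (e : Fin p × Fin p) : |pairSum0 θ e - pairSum0 θ' e| ≤ 2 * r := by
  have h1 := (norm_le_pi_norm (θ - θ') (Sum.inl e.1)).trans h
  have h2 := (norm_le_pi_norm (θ - θ') (Sum.inl e.2)).trans h
  rw [Real.norm_eq_abs, Pi.sub_apply, abs_le] at h1 h2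
  simp only [pairSum0, beta0]
  rw [abs_le]
  constructor <;> linarith

lemma abs_pairSum1_sub_le {p : ℕ} {θ θ' : Param p} {r : ℝ} (h : ‖θ - θ'‖ ≤ r)
    (e : Fin p × Fin p) : |pairSum1 θ e - pairSum1 θ' e| ≤ 2 * r := by
  have h1 := (norm_le_pi_norm (θ - θ') (Sum.inr e.1)).trans h
  have h2 := (norm_le_pi_norm (θ - θ') (Sum.inr e.2)).trans h
  rw [Real.norm_eq_abs, Pi.sub_apply, abs_le] at h1 h2
  simp only [pairSum1, beta1]
  rw [abs_le]
  constructor <;> linarith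

/-- The ball around a point of the sparse set may leave that set, so curvature is bounded on a
slightly larger one. -/
lemma sparseSet_enlarge {p : ℕ} {Cκ κ₀ κ₁ : ℝ} {θ θ' : Param p} (h : ‖θ - θ'‖ ≤ 1)
    (hθ' : θ' ∈ sparseSet p Cκ κ₀ κ₁) : θ ∈ sparseSet p (Cκ + 1) (κ₀ + 1) (κ₁ + 1) := by
  intro i
  have h1 := (norm_le_pi_norm (θ - θ') (Sum.inl i)).trans h
  have h2 := (norm_le_pi_norm (θ - θ') (Sum.inr i)).trans h
  rw [Real.norm_eq_abs, Pi.sub_apply, abs_le] at h1 h2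
  obtain ⟨⟨h3, h4⟩, h5⟩ := hθ' i
  simp only [beta0, beta1, abs_le] at *
  refine ⟨⟨?_, ?_⟩, ?_, ?_⟩ <;> linarith

/-! ### Curvature on the ball, with explicit constants -/

/-- The constant of the lower bound for the Hessian. -/
def hessConst (Cκ : ℝ) : ℝ := Real.exp (-6) / (8 * (1 + Real.exp (2 * (Cκ + 1))) ^ 3)

lemma hessConst_pos (Cκ : ℝ) : 0 < hessConst Cκ := by unfold hessConst; positivity

lemma edgeHess_stat_ge_of_mem {p : ℕ} {Cκ κ₀ κ₁ : ℝ} {θ : Param p}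
    (hθ : θ ∈ sparseSet p (Cκ + 1) (κ₀ + 1) (κ₁ + 1)) (e : Fin p × Fin p) (s w : ℝ) :
    hessConst Cκ * Real.exp (-2 * κ₀ - 4 * κ₁) * (s ^ 2 + w ^ 2) ≤
      edgeHess (stat00 (pairSum0 θ e) (pairSum1 θ e)) (stat11 (pairSum0 θ e) (pairSum1 θ e))
        (pairSum0 θ e) (pairSum1 θ e) s w s w := by
  obtain ⟨⟨h1, h2⟩, h3⟩ := hθ e.1
  obtain ⟨⟨h4, h5⟩, h6⟩ := hθ e.2
  have hκ : 0 ≤ κ₁ + 1 := (abs_nonneg _).trans h3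
  rw [abs_le] at h3 h6
  have key := edgeHess_stat_ge (u := pairSum0 θ e) (v := pairSum1 θ e)
    (M := Real.exp (2 * (Cκ + 1))) (T := Real.exp (2 * (κ₁ + 1)))
    (Real.exp_le_exp.2 (by simp only [pairSum0]; linarith)) (Real.one_le_exp (by linarith))
    (by rw [one_div, ← Real.exp_neg]; exact Real.exp_le_exp.2 (by simp only [pairSum1]; linarith))
    (Real.exp_le_exp.2 (by simp only [pairSum1]; linarith)) s w
  refine le_trans ?_ key
  gcongr
  -- The exponent `-6 = -2 · 1 - 4 · 1` pays for the enlargement of `κ₀` and `κ₁` by `1`.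
  have hT : Real.exp (-6) * Real.exp (-2 * κ₀ - 4 * κ₁) * Real.exp (2 * (κ₁ + 1)) ^ 2 ≤
      Real.exp (pairSum0 θ e) := by
    rw [← Real.exp_nat_mul, ← Real.exp_add, ← Real.exp_add]
    apply Real.exp_le_exp.2
    simp only [pairSum0]
    push_cast
    linarith
  rw [hessConst, div_mul_eq_mul_div, div_le_div_iff₀ (by positivity) (by positivity)]
  calc _ = Real.exp (-6) * Real.exp (-2 * κ₀ - 4 * κ₁) * Real.exp (2 * (κ₁ + 1)) ^ 2 *
        (8 * (1 + Real.exp (2 * (Cκ + 1))) ^ 3) := by ring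
    _ ≤ _ := by gcongr

/-- Lower bound for the Hessian in a ball, for arbitrary frequencies. -/
lemma totalHess_ge {p : ℕ} {Cκ κ₀ κ₁ r : ℝ} {θ θs : Param p} {A B : Fin p × Fin p → ℝ}
    (hθ : θ ∈ sparseSet p (Cκ + 1) (κ₀ + 1) (κ₁ + 1)) (hr : ‖θ - θs‖ ≤ r) (hr8 : 8 * r ≤ 1)
    (hrc : 192 * r ≤ hessConst Cκ * Real.exp (-2 * κ₀ - 4 * κ₁))
    (hA : ∀ e, 0 ≤ A e ∧ A e ≤ 1) (hB : ∀ e, 0 ≤ B e ∧ B e ≤ 1) (a : Param p) :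
    (1 / (p : ℝ)) * (hessConst Cκ * Real.exp (-2 * κ₀ - 4 * κ₁) / 2 *
        (((p : ℝ) - 2) * ∑ k, a k ^ 2)
      - ∑ e ∈ pairs p, (A e - stat00 (pairSum0 θs e) (pairSum1 θs e)) *
          logisticDeriv (pairSum1 θs e) * pairSum1 a e ^ 2
      - ∑ e ∈ pairs p, (B e - stat11 (pairSum0 θs e) (pairSum1 θs e)) *
          logisticDeriv2 (pairSum0 θs e) (pairSum1 θs e) * (pairSum0 a e - pairSum1 a e) ^ 2)
      ≤ totalHess A B θ a a := by
  set m := hessConst Cκ * Real.exp (-2 * κ₀ - 4 * κ₁) with hm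
  rw [totalHess]
  gcongr
  have hsum : ((p : ℝ) - 2) * ∑ k, a k ^ 2 ≤
      ∑ e ∈ pairs p, (pairSum0 a e ^ 2 + pairSum1 a e ^ 2) := by
    rw [Fintype.sum_sum_type, mul_add, Finset.sum_add_distrib]
    exact add_le_add (le_sum_pairs_sq fun i => a (Sum.inl i)) (le_sum_pairs_sq fun i => a (Sum.inr i))
  have hm0 : 0 ≤ m / 2 := by rw [hm]; have := hessConst_pos Cκ; positivity
  have h1 := mul_le_mul_of_nonneg_left hsum hm0
  refine le_trans (sub_le_sub_right (sub_le_sub_right h1 _) _) ?_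
  rw [Finset.mul_sum, ← Finset.sum_sub_distrib, ← Finset.sum_sub_distrib]
  refine Finset.sum_le_sum fun e _ => ?_
  have h2 := edgeHess_ge (abs_pairSum0_sub_le hr e) (abs_pairSum1_sub_le hr e) (by linarith)
    (hA e).1 (hA e).2 (hB e).1 (hB e).2 (pairSum0 a e) (pairSum1 a e)
  have h3 := edgeHess_stat_ge_of_mem hθ e (pairSum0 a e) (pairSum1 a e)
  rw [← hm] at h3
  -- A pair sum moves by up to `2r`, so the error is `96r`, at most half of the curvature: hence
  -- `192`.
  have h4 : 48 * (2 * r) * (pairSum0 a e ^ 2 + pairSum1 a e ^ 2) ≤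
      m / 2 * (pairSum0 a e ^ 2 + pairSum1 a e ^ 2) := by
    gcongr; linarith
  linarith

/-- The admissible radius of the ball. -/
def radiusConst (Cκ : ℝ) : ℝ := hessConst Cκ / 192

/-- Since `κ₀` may be negative, the exponential can exceed `1`; the bound `-κ₀ ≤ Cκ` and the factor
`(1 + M)³` in `hessConst` keep the radius small. -/
lemma radius_bounds {Cκ κ₀ κ₁ cr : ℝ} (h : -κ₀ ≤ Cκ) (h1 : 0 ≤ κ₁)
    (hcr : cr ≤ radiusConst Cκ) :
    192 * (cr * Real.exp (-2 * κ₀ - 4 * κ₁)) ≤ hessConst Cκ * Real.exp (-2 * κ₀ - 4 * κ₁) ∧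
      8 * (cr * Real.exp (-2 * κ₀ - 4 * κ₁)) ≤ 1 := by
  have e0 : Real.exp (-2 * κ₀ - 4 * κ₁) ≤ Real.exp (2 * (Cκ + 1)) :=
    Real.exp_le_exp.2 (by linarith)
  have e1 : Real.exp (-6) ≤ 1 := Real.exp_le_one_iff.2 (by norm_num)
  have hp := Real.exp_pos (-2 * κ₀ - 4 * κ₁)
  rw [radiusConst] at hcr
  have hA : 192 * (cr * Real.exp (-2 * κ₀ - 4 * κ₁)) ≤
      hessConst Cκ * Real.exp (-2 * κ₀ - 4 * κ₁) := by
    have := mul_le_mul_of_nonneg_right hcr hp.le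
    linarith
  refine ⟨hA, ?_⟩
  have hB : hessConst Cκ * Real.exp (-2 * κ₀ - 4 * κ₁) ≤ 1 := by
    rw [hessConst, div_mul_eq_mul_div, div_le_one (by positivity)]
    have hM := Real.exp_pos (2 * (Cκ + 1))
    generalize Real.exp (2 * (Cκ + 1)) = M at *
    have hM3 : M ≤ (1 + M) ^ 3 := by nlinarith [pow_pos hM 2, pow_pos hM 3]
    calc Real.exp (-6) * Real.exp (-2 * κ₀ - 4 * κ₁) ≤ 1 * M := by gcongr
      _ ≤ 8 * (1 + M) ^ 3 := by nlinarith
  linarith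

/-! ### Sub-Gaussian increments -/

open scoped NNReal

section subgaussian
variable {Ω : Type*} [MeasurableSpace Ω] {P : Measure Ω}

lemma hasSubgaussianMGF_mono {X : Ω → ℝ} {c d : ℝ≥0} (h : HasSubgaussianMGF X c P) (hcd : c ≤ d) :
    HasSubgaussianMGF X d P :=
  ⟨h.integrable_exp_mul, fun t => (h.mgf_le t).trans (Real.exp_le_exp.2 (by gcongr))⟩

lemma hasSubgaussianMGF_of_abs_le [IsProbabilityMeasure P] {X : Ω → ℝ} {K : ℝ≥0}
    (hm : AEMeasurable X P) (hb : ∀ ω, |X ω| ≤ K) (h0 : ∫ ω, X ω ∂P = 0) :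
    HasSubgaussianMGF X (K ^ 2) P := by
  have h := hasSubgaussianMGF_of_mem_Icc_of_integral_eq_zero (a := -(K : ℝ)) (b := K) hm
    (Filter.Eventually.of_forall fun ω => abs_le.1 (hb ω)) h0
  have hK : ‖(K : ℝ) - -(K : ℝ)‖₊ / 2 = K := by
    rw [sub_neg_eq_add, ← two_mul, nnnorm_mul]
    simp
  rwa [hK] at h

/-- Without independence the square roots of the proxies add: `(√c + √c)² = 4c`. -/
lemma hasSubgaussianMGF_add_same {X Y : Ω → ℝ} {c : ℝ≥0} (hX : HasSubgaussianMGF X c P)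
    (hY : HasSubgaussianMGF Y c P) : HasSubgaussianMGF (fun ω => X ω + Y ω) (4 * c) P := by
  have h := hX.add hY
  rwa [← two_mul, mul_pow, NNReal.sq_sqrt, show (2 : ℝ≥0) ^ 2 = 4 by norm_num] at h

/-- Adding a martingale increment that is driven by an independent innovation `Y` and depends on
the past only through a `0/1` state `x`. -/
lemma hasSubgaussianMGF_add_increment {N : Ω → ℝ} {x Y : Ω → ℤ} {c d : ℝ≥0}
    (hN : HasSubgaussianMGF N c P) (hx : Measurable x)
    (hx01 : ∀ ω, x ω = 0 ∨ x ω = 1)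
    (hind : IndepFun (fun ω => (N ω, x ω)) Y P) (G : ℤ → ℤ → ℝ)
    (hG0 : HasSubgaussianMGF (fun ω => G 0 (Y ω)) d P)
    (hG1 : HasSubgaussianMGF (fun ω => G 1 (Y ω)) d P) :
    HasSubgaussianMGF (fun ω => N ω + G (x ω) (Y ω)) (c + d) P := by
  -- On the event where the state is `k` the increment depends on the innovation alone, so
  -- independence factors the integral. The proxy `d` is the same for both states, so the two pieces
  -- recombine into the moment generating function of `N`.
  have key : ∀ (s : ℝ) (k : ℤ), HasSubgaussianMGF (fun ω => G k (Y ω)) d P →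
      Integrable (fun ω => (x ⁻¹' {k}).indicator (fun ω => Real.exp (s * N ω)) ω) P ∧
      Integrable (fun ω => (x ⁻¹' {k}).indicator (fun ω => Real.exp (s * N ω)) ω
        * Real.exp (s * G k (Y ω))) P ∧
      ∫ ω, (x ⁻¹' {k}).indicator (fun ω => Real.exp (s * N ω)) ω * Real.exp (s * G k (Y ω)) ∂P
        ≤ (∫ ω, (x ⁻¹' {k}).indicator (fun ω => Real.exp (s * N ω)) ω ∂P)
          * Real.exp (d * s ^ 2 / 2) := by
    intro s k hG
    have hi : Integrable (fun ω => (x ⁻¹' {k}).indicator (fun ω => Real.exp (s * N ω)) ω) P :=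
      (hN.integrable_exp_mul s).indicator (hx (measurableSet_singleton k))
    have hφ : Measurable fun z : ℝ × ℤ =>
        ((Prod.snd : ℝ × ℤ → ℤ) ⁻¹' {k}).indicator (fun z => Real.exp (s * z.1)) z := by
      refine Measurable.indicator (by fun_prop) (measurable_snd (measurableSet_singleton k))
    have hψ : Measurable fun y : ℤ => Real.exp (s * G k y) := measurable_from_top
    have hI : IndepFun (fun ω => (x ⁻¹' {k}).indicator (fun ω => Real.exp (s * N ω)) ω)
        (fun ω => Real.exp (s * G k (Y ω))) P := hind.comp hφ hψ
    refine ⟨hi, hI.integrable_mul hi (hG.integrable_exp_mul s), ?_⟩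
    rw [hI.integral_fun_mul_eq_mul_integral hi.aestronglyMeasurable
      (hG.integrable_exp_mul s).aestronglyMeasurable]
    refine mul_le_mul_of_nonneg_left (hG.mgf_le s) (integral_nonneg fun ω => ?_)
    exact Set.indicator_nonneg (fun _ _ => (Real.exp_pos _).le) _
  have split : ∀ s : ℝ, (fun ω => Real.exp (s * (N ω + G (x ω) (Y ω)))) = fun ω =>
      (x ⁻¹' {0}).indicator (fun ω => Real.exp (s * N ω)) ω * Real.exp (s * G 0 (Y ω))
      + (x ⁻¹' {1}).indicator (fun ω => Real.exp (s * N ω)) ω * Real.exp (s * G 1 (Y ω)) := by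
    intro s
    ext ω
    rcases hx01 ω with h | h <;> simp [Set.indicator, h, mul_add, Real.exp_add]
  have hsum : ∀ s : ℝ, (fun ω => Real.exp (s * N ω)) = fun ω =>
      (x ⁻¹' {0}).indicator (fun ω => Real.exp (s * N ω)) ω
      + (x ⁻¹' {1}).indicator (fun ω => Real.exp (s * N ω)) ω := by
    intro s
    ext ω
    rcases hx01 ω with h | h <;> simp [Set.indicator, h]
  refine ⟨fun s => ?_, fun s => ?_⟩
  · rw [split]
    exact (key s 0 hG0).2.1.add (key s 1 hG1).2.1
  · obtain ⟨a1, a2, a3⟩ := key s 0 hG0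
    obtain ⟨b1, b2, b3⟩ := key s 1 hG1
    have hmgf : mgf N P s = (∫ ω, (x ⁻¹' {0}).indicator (fun ω => Real.exp (s * N ω)) ω ∂P)
        + ∫ ω, (x ⁻¹' {1}).indicator (fun ω => Real.exp (s * N ω)) ω ∂P := by
      rw [← integral_add a1 b1]
      exact congrArg (fun f : Ω → ℝ => ∫ ω, f ω ∂P) (hsum s)
    rw [mgf, split, integral_add a2 b2]
    calc _ ≤ mgf N P s * Real.exp (d * s ^ 2 / 2) := by rw [hmgf, add_mul]; exact add_le_add a3 b3
      _ ≤ Real.exp (c * s ^ 2 / 2) * Real.exp (d * s ^ 2 / 2) := by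
        gcongr; exact hN.mgf_le s
      _ = _ := by rw [← Real.exp_add]; congr 1; push_cast; ring

end subgaussian

/-! ### The Markov chain of one pair -/

/-- The dynamics of a single pair: a stationary `0/1` Markov chain driven by the independent
innovations `Y 1, Y 2, …`, with `Y 0` the initial state. -/
structure IsEdgeChain {Ω : Type*} [MeasurableSpace Ω] (P : Measure Ω) (u v : ℝ)
    (x Y : ℕ → Ω → ℤ) : Prop where
  zero_or_one : ∀ t ω, x t ω = 0 ∨ x t ω = 1
  init : ∀ ω, x 0 ω = Y 0 ω
  step : ∀ t ω, x (t + 1) ω =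
    (if Y (t + 1) ω = 0 then 1 else 0) + x t ω * (if Y (t + 1) ω = 1 then 1 else 0)
  measurable : ∀ t, Measurable (Y t)
  indep : iIndepFun Y P
  innov_zero : ∀ t, P.real {ω | Y (t + 1) ω = 0} = Real.exp u / (1 + Real.exp u + Real.exp v)
  innov_one : ∀ t, P.real {ω | Y (t + 1) ω = 1} = Real.exp v / (1 + Real.exp u + Real.exp v)
  init_one : P.real {ω | x 0 ω = 1} = Real.exp u / (1 + Real.exp u)

/-- The increment `x_{t+1} - E(x_{t+1} | x_t)` as a function of `x_t` and of the innovation. -/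
def increment (u v : ℝ) (x y : ℤ) : ℝ :=
  (if y = 0 then 1 else 0) - Real.exp u / (1 + Real.exp u + Real.exp v)
    + x * ((if y = 1 then 1 else 0) - Real.exp v / (1 + Real.exp u + Real.exp v))

namespace IsEdgeChain

variable {Ω : Type*} [MeasurableSpace Ω] {P : Measure Ω} {u v : ℝ} {x Y : ℕ → Ω → ℤ}

/-- The past of the innovations up to time `t`. -/
@[reducible] def past {Ω : Type*} (Y : ℕ → Ω → ℤ) (t : ℕ) : MeasurableSpace Ω :=
  ⨆ s ∈ Set.Iic t, MeasurableSpace.comap (Y s) inferInstance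

lemma past_mono {Ω : Type*} (Y : ℕ → Ω → ℤ) {s t : ℕ} (h : s ≤ t) : past Y s ≤ past Y t :=
  biSup_mono fun _ hi => le_trans hi h

lemma measurable_past {Ω : Type*} (Y : ℕ → Ω → ℤ) (t : ℕ) : Measurable[past Y t] (Y t) :=
  measurable_iff_comap_le.2 (le_biSup (fun s => MeasurableSpace.comap (Y s) inferInstance)
    (Set.self_mem_Iic (a := t)))

lemma past_le (h : IsEdgeChain P u v x Y) (t : ℕ) : past Y t ≤ ‹MeasurableSpace Ω› :=
  iSup₂_le fun s _ => (h.measurable s).comap_le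

lemma measurable_state_past (h : IsEdgeChain P u v x Y) (t : ℕ) : Measurable[past Y t] (x t) := by
  induction t with
  | zero =>
    rw [show x 0 = Y 0 from funext h.init]
    exact measurable_past Y 0
  | succ t ih =>
    rw [show x (t + 1) = fun ω => (fun z : ℤ × ℤ => (if z.2 = 0 then 1 else 0)
      + z.1 * (if z.2 = 1 then 1 else 0)) (x t ω, Y (t + 1) ω) from funext (h.step t)]
    exact Measurable.comp (measurable_of_countable fun z : ℤ × ℤ =>
      (if z.2 = 0 then 1 else 0) + z.1 * (if z.2 = 1 then 1 else 0))
      ((ih.mono (past_mono Y t.le_succ) le_rfl).prodMk (measurable_past Y (t + 1)))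

lemma measurable_state (h : IsEdgeChain P u v x Y) (t : ℕ) : Measurable (x t) :=
  (h.measurable_state_past t).mono (h.past_le t) le_rfl

lemma indepFun_next (h : IsEdgeChain P u v x Y) {β : Type*} [MeasurableSpace β] {t : ℕ} {f : Ω → β}
    (hf : Measurable[past Y t] f) : IndepFun f (Y (t + 1)) P := by
  have h1 := indep_iSup_of_disjoint (m := fun s => MeasurableSpace.comap (Y s) inferInstance)
    (μ := P) (fun s => (h.measurable s).comap_le) h.indep.iIndep (S := Set.Iic t) (T := {t + 1}) (by simp)
  rw [IndepFun_iff_Indep]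
  refine indep_of_indep_of_le_left (indep_of_indep_of_le_right h1 ?_) hf.comap_le
  simp

lemma state_eq_indicator (h : IsEdgeChain P u v x Y) (t : ℕ) (ω : Ω) :
    (x t ω : ℝ) = if x t ω = 1 then 1 else 0 := by
  rcases h.zero_or_one t ω with h | h <;> simp [h]

lemma integrable_of_abs_le [IsProbabilityMeasure P] {f : Ω → ℝ} (hf : Measurable f) {C : ℝ}
    (hC : ∀ ω, |f ω| ≤ C) : Integrable f P :=
  Integrable.of_bound hf.aestronglyMeasurable C (Filter.Eventually.of_forall hC)

lemma integral_indicator_eq {y : Ω → ℤ} (hy : Measurable y) (k : ℤ) :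
    ∫ ω, (if y ω = k then (1 : ℝ) else 0) ∂P = P.real {ω | y ω = k} := by
  have := integral_indicator_one (μ := P) (hy (measurableSet_singleton k))
  simp only [Set.indicator, Set.mem_preimage, Set.mem_singleton_iff, Pi.one_apply] at this
  exact this

lemma measurable_cast {y : Ω → ℤ} (hy : Measurable y) (g : ℤ → ℝ) : Measurable fun ω => g (y ω) :=
  (measurable_from_top (f := g)).comp hy

lemma integral_state_mul [IsProbabilityMeasure P] (h : IsEdgeChain P u v x Y) (t : ℕ) (k : ℤ) :
    ∫ ω, (x t ω : ℝ) * (if Y (t + 1) ω = k then 1 else 0) ∂P =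
      (∫ ω, (x t ω : ℝ) ∂P) * P.real {ω | Y (t + 1) ω = k} := by
  have hI := (h.indepFun_next (h.measurable_state_past t)).comp
    (measurable_from_top (f := fun z : ℤ => (z : ℝ)))
    (measurable_from_top (f := fun z : ℤ => if z = k then (1 : ℝ) else 0))
  rw [← integral_indicator_eq (h.measurable (t + 1))]
  exact hI.integral_fun_mul_eq_mul_integral
    (measurable_cast (h.measurable_state t) _).aestronglyMeasurable
    (measurable_cast (h.measurable (t + 1))
      fun z : ℤ => if z = k then (1 : ℝ) else 0).aestronglyMeasurable

lemma abs_state_le (h : IsEdgeChain P u v x Y) (t : ℕ) (ω : Ω) : |(x t ω : ℝ)| ≤ 1 := by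
  rcases h.zero_or_one t ω with h | h <;> simp [h]

lemma integrable_state [IsProbabilityMeasure P] (h : IsEdgeChain P u v x Y) (t : ℕ) :
    Integrable (fun ω => (x t ω : ℝ)) P :=
  integrable_of_abs_le (measurable_cast (h.measurable_state t) _) (h.abs_state_le t)

lemma integrable_indicator [IsProbabilityMeasure P] {y : Ω → ℤ} (hy : Measurable y) (k : ℤ) :
    Integrable (fun ω => if y ω = k then (1 : ℝ) else 0) P :=
  integrable_of_abs_le (measurable_cast hy fun z => if z = k then (1 : ℝ) else 0) (C := 1)
    fun ω => by split_ifs <;> simp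

lemma integrable_state_mul [IsProbabilityMeasure P] (h : IsEdgeChain P u v x Y) (t : ℕ) (k : ℤ) :
    Integrable (fun ω => (x t ω : ℝ) * (if Y (t + 1) ω = k then 1 else 0)) P :=
  integrable_of_abs_le ((measurable_cast (h.measurable_state t) _).mul
    (measurable_cast (h.measurable (t + 1)) fun z => if z = k then (1 : ℝ) else 0)) (C := 1)
    fun ω => by rcases h.zero_or_one t ω with h | h <;> rw [h] <;> split_ifs <;> simp

/-- The chain is stationary. -/
lemma integral_state [IsProbabilityMeasure P] (h : IsEdgeChain P u v x Y) (t : ℕ) :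
    ∫ ω, (x t ω : ℝ) ∂P = Real.exp u / (1 + Real.exp u) := by
  induction t with
  | zero =>
    simp_rw [h.state_eq_indicator 0]
    rw [integral_indicator_eq (h.measurable_state 0), h.init_one]
  | succ t ih =>
    have h1 : ∀ ω, (x (t + 1) ω : ℝ) = (if Y (t + 1) ω = 0 then 1 else 0)
        + (x t ω : ℝ) * (if Y (t + 1) ω = 1 then 1 else 0) := fun ω => by
      rw [h.step t ω]; push_cast; rfl
    simp_rw [h1]
    rw [integral_add (integrable_indicator (h.measurable _) 0) (h.integrable_state_mul t 1),
      integral_indicator_eq (h.measurable _), h.integral_state_mul, ih, h.innov_zero, h.innov_one]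
    have := Real.exp_pos u
    have := Real.exp_pos v
    field_simp

lemma state_mul_state (h : IsEdgeChain P u v x Y) (t : ℕ) (ω : Ω) :
    (x t ω : ℝ) * x (t + 1) ω = (x t ω : ℝ) * (if Y (t + 1) ω = 0 then 1 else 0)
      + (x t ω : ℝ) * (if Y (t + 1) ω = 1 then 1 else 0) := by
  rw [h.step t ω]
  rcases h.zero_or_one t ω with h | h <;> simp [h]

lemma integral_state_mul_state [IsProbabilityMeasure P] (h : IsEdgeChain P u v x Y) (t : ℕ) :
    ∫ ω, (x t ω : ℝ) * x (t + 1) ω ∂P = stat11 u v := by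
  simp_rw [h.state_mul_state]
  rw [integral_add (h.integrable_state_mul t 0) (h.integrable_state_mul t 1),
    h.integral_state_mul, h.integral_state_mul, h.integral_state, h.innov_zero, h.innov_one,
    stat11]
  have := Real.exp_pos u
  have := Real.exp_pos v
  field_simp

lemma integrable_state_mul_state [IsProbabilityMeasure P] (h : IsEdgeChain P u v x Y) (t : ℕ) :
    Integrable (fun ω => (x t ω : ℝ) * x (t + 1) ω) P := by
  simp_rw [h.state_mul_state]
  exact (h.integrable_state_mul t 0).add (h.integrable_state_mul t 1)

/-- Take expectations in `(1 - x)(1 - x') = 1 - x - x' + x x'`, where both states have the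
stationary mean. -/
lemma stat00_eq (u v : ℝ) : stat00 u v = 1 - 2 * (Real.exp u / (1 + Real.exp u)) + stat11 u v := by
  have := Real.exp_pos u
  have := Real.exp_pos v
  rw [stat00, stat11]
  field_simp
  ring

lemma integrable_freq11 [IsProbabilityMeasure P] (h : IsEdgeChain P u v x Y) (n : ℕ) :
    Integrable (fun ω => freq11 n fun t => x t ω) P := by
  unfold freq11
  exact (integrable_finsetSum _ fun t _ => h.integrable_state_mul_state t).div_const _

lemma one_sub_mul_one_sub (a b : ℝ) : (1 - a) * (1 - b) = 1 - a - b + a * b := by ring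

lemma integrable_freq00 [IsProbabilityMeasure P] (h : IsEdgeChain P u v x Y) (n : ℕ) :
    Integrable (fun ω => freq00 n fun t => x t ω) P := by
  unfold freq00
  simp_rw [one_sub_mul_one_sub]
  exact (integrable_finsetSum _ fun t _ => (((integrable_const 1).sub' (h.integrable_state t)).sub'
    (h.integrable_state (t + 1))).fun_add (h.integrable_state_mul_state t)).div_const _

lemma integral_freq11 [IsProbabilityMeasure P] (h : IsEdgeChain P u v x Y) {n : ℕ} (hn : 1 ≤ n) :
    ∫ ω, freq11 n (fun t => x t ω) ∂P = stat11 u v := by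
  have hn' : (n : ℝ) ≠ 0 := by positivity
  unfold freq11
  rw [integral_div, integral_finsetSum _ fun t _ => h.integrable_state_mul_state t]
  simp_rw [h.integral_state_mul_state]
  simp [hn']

lemma integral_freq00 [IsProbabilityMeasure P] (h : IsEdgeChain P u v x Y) {n : ℕ} (hn : 1 ≤ n) :
    ∫ ω, freq00 n (fun t => x t ω) ∂P = stat00 u v := by
  have hn' : (n : ℝ) ≠ 0 := by positivity
  have key : ∀ t, ∫ ω, (1 - (x t ω : ℝ) - x (t + 1) ω + x t ω * x (t + 1) ω) ∂P = stat00 u v := by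
    intro t
    rw [integral_add (((integrable_const 1).sub' (h.integrable_state t)).sub'
      (h.integrable_state (t + 1))) (h.integrable_state_mul_state t),
      integral_sub ((integrable_const 1).sub' (h.integrable_state t)) (h.integrable_state (t + 1)),
      integral_sub (integrable_const 1) (h.integrable_state t), h.integral_state,
      h.integral_state, h.integral_state_mul_state, stat00_eq]
    simp
    ring
  unfold freq00
  simp_rw [one_sub_mul_one_sub]
  have hi : ∀ t, Integrable (fun ω => 1 - (x t ω : ℝ) - x (t + 1) ω + x t ω * x (t + 1) ω) P :=
    fun t => (((integrable_const 1).sub' (h.integrable_state t)).sub'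
      (h.integrable_state (t + 1))).fun_add (h.integrable_state_mul_state t)
  rw [integral_div, integral_finsetSum _ fun t _ => hi t]
  simp_rw [key]
  simp [hn']

lemma state_succ (h : IsEdgeChain P u v x Y) (t : ℕ) (ω : Ω) :
    (x (t + 1) ω : ℝ) = Real.exp u / (1 + Real.exp u + Real.exp v)
      + Real.exp v / (1 + Real.exp u + Real.exp v) * x t ω + increment u v (x t ω) (Y (t + 1) ω) := by
  rw [h.step t ω, increment]
  push_cast
  ring

lemma integral_increment [IsProbabilityMeasure P] (h : IsEdgeChain P u v x Y) (t : ℕ) (k : ℤ) :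
    ∫ ω, increment u v k (Y (t + 1) ω) ∂P = 0 := by
  have i0 := integrable_indicator (P := P) (h.measurable (t + 1)) 0
  have i1 := integrable_indicator (P := P) (h.measurable (t + 1)) 1
  unfold increment
  rw [integral_add (i0.sub' (integrable_const _)) ((i1.sub' (integrable_const _)).const_mul _),
    integral_sub i0 (integrable_const _), integral_const_mul, integral_sub i1 (integrable_const _),
    integral_indicator_eq (h.measurable _), integral_indicator_eq (h.measurable _), h.innov_zero,
    h.innov_one]
  simp

lemma abs_increment_le (u v : ℝ) {k : ℤ} (hk : k = 0 ∨ k = 1) (y : ℤ) :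
    |increment u v k y| ≤ 1 := by
  have hu := Real.exp_pos u
  have hv := Real.exp_pos v
  have h0 : 0 ≤ Real.exp u / (1 + Real.exp u + Real.exp v) := by positivity
  have h1 : 0 ≤ Real.exp v / (1 + Real.exp u + Real.exp v) := by positivity
  have h2 : Real.exp u / (1 + Real.exp u + Real.exp v)
      + Real.exp v / (1 + Real.exp u + Real.exp v) ≤ 1 := by
    rw [← add_div, div_le_one (by positivity)]; linarith
  unfold increment
  rw [abs_le]
  rcases hk with rfl | rfl <;> by_cases hy0 : y = 0 <;> by_cases hy1 : y = 1 <;>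
    simp [hy0, hy1] <;> (try constructor) <;> linarith

/-- A martingale transform of the chain. -/
def transform (u v : ℝ) (x Y : ℕ → Ω → ℤ) (c : ℝ) (n : ℕ) (ω : Ω) : ℝ :=
  ∑ t ∈ Finset.range n, (c + x t ω) * increment u v (x t ω) (Y (t + 1) ω)

lemma measurable_transform (h : IsEdgeChain P u v x Y) (c : ℝ) (n : ℕ) :
    Measurable[past Y n] (transform u v x Y c n) := by
  unfold transform
  refine Finset.measurable_fun_sum _ fun t ht => ?_
  have ht' := Finset.mem_range.1 ht
  have h1 : Measurable[past Y n] (fun ω => (x t ω, Y (t + 1) ω)) :=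
    ((h.measurable_state_past t).mono (past_mono Y ht'.le) le_rfl).prodMk
      ((measurable_past Y (t + 1)).mono (past_mono Y ht') le_rfl)
  exact (measurable_of_countable
    (fun z : ℤ × ℤ => (c + (z.1 : ℝ)) * increment u v z.1 z.2)).comp h1

/-- An Azuma-type induction: each step adds an increment bounded by `K` and centred given the past,
since the factor `c + x_t` takes only the values `c` and `c + 1`. -/
lemma hasSubgaussianMGF_transform [IsProbabilityMeasure P] (h : IsEdgeChain P u v x Y) {c : ℝ}
    {K : ℝ≥0} (hc : |c| ≤ K) (hc' : |c + 1| ≤ K) (n : ℕ) :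
    HasSubgaussianMGF (transform u v x Y c n) (n * K ^ 2) P := by
  induction n with
  | zero =>
    have : transform u v x Y c 0 = fun _ => 0 := by ext; simp [transform]
    rw [this]
    simp
  | succ n ih =>
    have hG : ∀ k : ℤ, k = 0 ∨ k = 1 → |c + k| ≤ K →
        HasSubgaussianMGF (fun ω => (c + k) * increment u v k (Y (n + 1) ω)) (K ^ 2) P := by
      intro k hk hck
      refine hasSubgaussianMGF_of_abs_le (measurable_cast (h.measurable (n + 1))
        fun z => (c + k) * increment u v k z).aemeasurable (fun ω => ?_) ?_
      · rw [abs_mul]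
        calc |c + k| * |increment u v k (Y (n + 1) ω)| ≤ K * 1 := by
              gcongr; exact abs_increment_le u v hk _
          _ = K := mul_one _
      · rw [integral_const_mul, h.integral_increment, mul_zero]
    have hm := h.measurable_transform c n
    have := hasSubgaussianMGF_add_increment ih
      (h.measurable_state n) (h.zero_or_one n)
      (h.indepFun_next (hm.prodMk (h.measurable_state_past n)))
      (fun k y => (c + k) * increment u v k y) (hG 0 (Or.inl rfl) (by simpa using hc))
      (hG 1 (Or.inr rfl) (by simpa using hc'))
    have e1 : transform u v x Y c (n + 1) = fun ω => transform u v x Y c n ω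
        + (c + x n ω) * increment u v (x n ω) (Y (n + 1) ω) := by
      ext ω; simp [transform, Finset.sum_range_succ]
    rw [e1]
    convert this using 1
    push_cast; ring

lemma hasSubgaussianMGF_transform_add [IsProbabilityMeasure P] (h : IsEdgeChain P u v x Y)
    {c d : ℝ} {K : ℝ≥0} (hc : |c| ≤ K) (hc' : |c + 1| ≤ K) (hd : |d| ≤ K) {n : ℕ} (hn : 1 ≤ n) :
    HasSubgaussianMGF (fun ω => transform u v x Y c n ω + d * ((x 0 ω : ℝ) - x n ω))
      (4 * (n * K ^ 2)) P := by
  have h2 : HasSubgaussianMGF (fun ω => d * ((x 0 ω : ℝ) - x n ω)) (K ^ 2) P := by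
    refine hasSubgaussianMGF_of_abs_le (((measurable_cast (h.measurable_state 0) _).sub
      (measurable_cast (h.measurable_state n) _)).const_mul d).aemeasurable (fun ω => ?_) ?_
    · rw [abs_mul]
      have : |(x 0 ω : ℝ) - x n ω| ≤ 1 := by
        rcases h.zero_or_one 0 ω with h0 | h0 <;> rcases h.zero_or_one n ω with h1 | h1 <;>
          simp [h0, h1]
      calc _ ≤ (K : ℝ) * 1 := by gcongr
        _ = K := mul_one _
    · rw [integral_const_mul, integral_sub (h.integrable_state 0) (h.integrable_state n),
        h.integral_state, h.integral_state, sub_self, mul_zero]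
  refine hasSubgaussianMGF_add_same (h.hasSubgaussianMGF_transform hc hc' n) (hasSubgaussianMGF_mono h2 ?_)
  calc K ^ 2 = 1 * K ^ 2 := (one_mul _).symm
    _ ≤ n * K ^ 2 := by gcongr; exact_mod_cast hn

end IsEdgeChain
-- Concentration of the transition frequencies
lemma freq00_mem {n : ℕ} {x : ℕ → ℤ} (hx : ∀ t, x t = 0 ∨ x t = 1) :
    0 ≤ freq00 n x ∧ freq00 n x ≤ 1 := by
  have h : ∀ t, 0 ≤ (1 - (x t : ℝ)) * (1 - (x (t + 1) : ℝ)) ∧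
      (1 - (x t : ℝ)) * (1 - (x (t + 1) : ℝ)) ≤ 1 := by
    intro t
    rcases hx t with h | h <;> rcases hx (t + 1) with h' | h' <;> simp [h, h']
  refine ⟨div_nonneg (Finset.sum_nonneg fun t _ => (h t).1) n.cast_nonneg,
    div_le_one_of_le₀ ?_ n.cast_nonneg⟩
  exact (Finset.sum_le_sum fun t _ => (h t).2).trans (by simp)

lemma freq11_mem {n : ℕ} {x : ℕ → ℤ} (hx : ∀ t, x t = 0 ∨ x t = 1) :
    0 ≤ freq11 n x ∧ freq11 n x ≤ 1 := by
  have h : ∀ t, 0 ≤ (x t : ℝ) * (x (t + 1) : ℝ) ∧ (x t : ℝ) * (x (t + 1) : ℝ) ≤ 1 := by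
    intro t
    rcases hx t with h | h <;> rcases hx (t + 1) with h' | h' <;> simp [h, h']
  refine ⟨div_nonneg (Finset.sum_nonneg fun t _ => (h t).1) n.cast_nonneg,
    div_le_one_of_le₀ ?_ n.cast_nonneg⟩
  exact (Finset.sum_le_sum fun t _ => (h t).2).trans (by simp)

section subgaussian
variable {Ω : Type*} [MeasurableSpace Ω] {P : Measure Ω}

lemma hasSubgaussianMGF_mul {X : Ω → ℝ} {c : ℝ≥0} (h : HasSubgaussianMGF X c P) {r : ℝ} {d : ℝ≥0}
    (hd : r ^ 2 * c ≤ d) : HasSubgaussianMGF (fun ω => r * X ω) d P :=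
  hasSubgaussianMGF_mono (h.const_mul r) (by rw [← NNReal.coe_le_coe]; exact hd)

end subgaussian

namespace IsEdgeChain

variable {Ω : Type*} [MeasurableSpace Ω] {P : Measure Ω} {u v : ℝ} {x Y : ℕ → Ω → ℤ}

/-- Poisson equation. With `λ = e^v/(1 + e^u + e^v)`, one step gives `(1 - λ)(x_t - π) = x_t -
x_{t+1} + m_{t+1}`, where `π` is the stationary mean and `m` the increment. Since `x_t² = x_t`, the
conditional mean of `x_t x_{t+1}` is linear in `x_t`, with slope `(1 - λ)` times the constant `(e^u
+ e^v)/(1 + e^u)`. The boundary terms telescope. -/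
lemma sum_state_mul_state (h : IsEdgeChain P u v x Y) (n : ℕ) (ω : Ω) :
    ∑ t ∈ Finset.range n, (x t ω : ℝ) * x (t + 1) ω - n * stat11 u v =
      transform u v x Y ((Real.exp u + Real.exp v) / (1 + Real.exp u)) n ω
      + (Real.exp u + Real.exp v) / (1 + Real.exp u) * ((x 0 ω : ℝ) - x n ω) := by
  induction n with
  | zero => simp [transform]
  | succ n ih =>
    rw [transform] at ih ⊢
    rw [Finset.sum_range_succ, Finset.sum_range_succ]
    have hs := h.state_succ n ω
    have key : (x n ω : ℝ) * x (n + 1) ω - stat11 u v =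
        ((Real.exp u + Real.exp v) / (1 + Real.exp u) + x n ω)
          * increment u v (x n ω) (Y (n + 1) ω)
        + (Real.exp u + Real.exp v) / (1 + Real.exp u) * ((x n ω : ℝ) - x (n + 1) ω) := by
      rw [hs, stat11]
      have := Real.exp_pos u
      have := Real.exp_pos v
      generalize increment u v (x n ω) (Y (n + 1) ω) = m
      rcases h.zero_or_one n ω with h0 | h0 <;> rw [h0] <;> push_cast <;> field_simp <;> ring
    push_cast
    linarith

lemma sum_one_sub_mul_one_sub (h : IsEdgeChain P u v x Y) (n : ℕ) (ω : Ω) :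
    ∑ t ∈ Finset.range n, (1 - (x t ω : ℝ)) * (1 - (x (t + 1) ω : ℝ)) - n * stat00 u v =
      transform u v x Y (-((2 + Real.exp u + Real.exp v) / (1 + Real.exp u))) n ω
      + (1 - (2 + Real.exp u + Real.exp v) / (1 + Real.exp u)) * ((x 0 ω : ℝ) - x n ω) := by
  induction n with
  | zero => simp [transform]
  | succ n ih =>
    rw [transform] at ih ⊢
    rw [Finset.sum_range_succ, Finset.sum_range_succ]
    have hs := h.state_succ n ω
    have key : (1 - (x n ω : ℝ)) * (1 - (x (n + 1) ω : ℝ)) - stat00 u v =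
        (-((2 + Real.exp u + Real.exp v) / (1 + Real.exp u)) + x n ω)
          * increment u v (x n ω) (Y (n + 1) ω)
        + (1 - (2 + Real.exp u + Real.exp v) / (1 + Real.exp u))
          * ((x n ω : ℝ) - x (n + 1) ω) := by
      rw [hs, stat00]
      have := Real.exp_pos u
      have := Real.exp_pos v
      generalize increment u v (x n ω) (Y (n + 1) ω) = m
      rcases h.zero_or_one n ω with h0 | h0 <;> rw [h0] <;> push_cast <;> field_simp <;> ring
    push_cast
    linarith

/-- The coefficient of the Poisson equation is at most `1 + e^v` whatever `u` is, so sparsity does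
not worsen the rate `1/n`. -/
lemma hasSubgaussianMGF_freq11 [IsProbabilityMeasure P] (h : IsEdgeChain P u v x Y) {K : ℝ≥0}
    (hK : 3 * (1 + Real.exp v) ≤ K) {n : ℕ} (hn : 1 ≤ n) :
    HasSubgaussianMGF (fun ω => freq11 n (fun t => x t ω) - stat11 u v) (4 * K ^ 2 / n) P := by
  have hu := Real.exp_pos u
  have hv := Real.exp_pos v
  have hk1 : (Real.exp u + Real.exp v) / (1 + Real.exp u) ≤ 1 + Real.exp v := by
    rw [div_le_iff₀ (by positivity)]; nlinarith
  have hk0 : 0 ≤ (Real.exp u + Real.exp v) / (1 + Real.exp u) := by positivity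
  have key := h.hasSubgaussianMGF_transform_add (c := (Real.exp u + Real.exp v) / (1 + Real.exp u))
    (d := (Real.exp u + Real.exp v) / (1 + Real.exp u)) (K := K)
    (abs_le.2 ⟨by linarith, by linarith⟩) (abs_le.2 ⟨by linarith, by linarith⟩)
    (abs_le.2 ⟨by linarith, by linarith⟩) hn
  have hn' : (n : ℝ) ≠ 0 := by positivity
  have key2 := hasSubgaussianMGF_mul key (r := 1 / n) (d := 4 * K ^ 2 / n)
    (le_of_eq (by push_cast; field_simp))
  convert key2 using 2 with ω
  rw [← h.sum_state_mul_state n ω, freq11]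
  field_simp

lemma hasSubgaussianMGF_freq00 [IsProbabilityMeasure P] (h : IsEdgeChain P u v x Y) {K : ℝ≥0}
    (hK : 3 * (1 + Real.exp v) ≤ K) {n : ℕ} (hn : 1 ≤ n) :
    HasSubgaussianMGF (fun ω => freq00 n (fun t => x t ω) - stat00 u v) (4 * K ^ 2 / n) P := by
  have hu := Real.exp_pos u
  have hv := Real.exp_pos v
  have hk1 : (2 + Real.exp u + Real.exp v) / (1 + Real.exp u) ≤ 2 + Real.exp v := by
    rw [div_le_iff₀ (by positivity)]; nlinarith
  have hk0 : 0 ≤ (2 + Real.exp u + Real.exp v) / (1 + Real.exp u) := by positivity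
  have key := h.hasSubgaussianMGF_transform_add
    (c := -((2 + Real.exp u + Real.exp v) / (1 + Real.exp u)))
    (d := 1 - (2 + Real.exp u + Real.exp v) / (1 + Real.exp u)) (K := K)
    (abs_le.2 ⟨by linarith, by linarith⟩) (abs_le.2 ⟨by linarith, by linarith⟩)
    (abs_le.2 ⟨by linarith, by linarith⟩) hn
  have hn' : (n : ℝ) ≠ 0 := by positivity
  have key2 := hasSubgaussianMGF_mul key (r := 1 / n) (d := 4 * K ^ 2 / n)
    (le_of_eq (by push_cast; field_simp))
  convert key2 using 2 with ω
  rw [← h.sum_one_sub_mul_one_sub n ω, freq00]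
  field_simp

end IsEdgeChain

/-! ### Independence across pairs -/

/-- The pairs of distinct nodes, as a type. -/
abbrev Pair (p : ℕ) : Type := {e : Fin p × Fin p // e.1 < e.2}

/-- The sequence of independent variables that drives a pair. -/
def driver {p : ℕ} {Ω : Type*} (X ε : ℕ → Fin p → Fin p → Ω → ℤ) (e : Pair p) (t : ℕ) (ω : Ω) : ℤ :=
  if t = 0 then X 0 e.1.1 e.1.2 ω else ε t e.1.1 e.1.2 ω

/-- Grouping the coordinates of a product measure by their first index gives a product of product
measures. -/
lemma iIndepFun_curry {ι κ Ω 𝓧 : Type*} [MeasurableSpace Ω] [MeasurableSpace 𝓧] {P : Measure Ω}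
    {X : ι → κ → Ω → 𝓧} (mX : ∀ i j, Measurable (X i j))
    (h : iIndepFun (fun (q : ι × κ) ω => X q.1 q.2 ω) P) :
    iIndepFun (fun i ω j => X i j ω) P := by
  have := h.isProbabilityMeasure
  have h' : iIndepFun (fun (q : (_ : ι) × κ) ω => X q.1 q.2 ω) P :=
    h.precomp (g := fun q : (_ : ι) × κ => (q.1, q.2)) (Equiv.sigmaEquivProd ι κ).injective
  have : ∀ i j, IsProbabilityMeasure (P.map (X i j)) :=
    fun i j ↦ Measure.isProbabilityMeasure_map (mX i j).aemeasurable
  have hrow : ∀ i, P.map (fun ω j => X i j ω) = Measure.infinitePi fun j => P.map (X i j) := by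
    intro i
    have hi : iIndepFun (X i) P := h.precomp (g := fun j => (i, j)) fun a b hab => by simpa using hab
    exact (iIndepFun_iff_map_fun_eq_infinitePi_map (by fun_prop)).1 hi
  have hcomp : (MeasurableEquiv.piCurry fun (_ : ι) (_ : κ) => 𝓧) ∘ (fun ω p ↦ X p.1 p.2 ω)
      = fun ω i j ↦ X i j ω := by
    ext; simp [Sigma.curry]
  rw [iIndepFun_iff_map_fun_eq_infinitePi_map (by fun_prop)]
  simp_rw [hrow]
  rw [← Measure.infinitePi_map_piCurry (fun i j ↦ P.map (X i j)),
    ← (iIndepFun_iff_map_fun_eq_infinitePi_map (X := fun (q : (_ : ι) × κ) ω => X q.1 q.2 ω)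
      (by fun_prop)).1 h', Measure.map_map (by fun_prop) (by fun_prop), hcomp]

/-- The `0/1` sequence generated by an initial state and innovations. -/
def orbit (y : ℕ → ℤ) : ℕ → ℤ
  | 0 => y 0
  | t + 1 => (if y (t + 1) = 0 then 1 else 0) + orbit y t * (if y (t + 1) = 1 then 1 else 0)

lemma measurable_orbit (t : ℕ) : Measurable fun y : ℕ → ℤ => orbit y t := by
  induction t with
  | zero => exact measurable_pi_apply 0
  | succ t ih =>
    have h1 : Measurable fun y : ℕ → ℤ => (orbit y t, y (t + 1)) :=
      ih.prodMk (measurable_pi_apply (t + 1))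
    exact (measurable_of_countable fun z : ℤ × ℤ =>
      (if z.2 = 0 then 1 else 0) + z.1 * (if z.2 = 1 then 1 else 0)).comp h1

section model

variable {p : ℕ} {θ : Param p} {Ω : Type*} [MeasurableSpace Ω] {P : Measure Ω}
  {X ε : ℕ → Fin p → Fin p → Ω → ℤ}

lemma IsModelWith.measurable_driver (h : IsModelWith θ P X ε) (e : Pair p) (t : ℕ) :
    Measurable (driver X ε e t) := by
  unfold driver
  split_ifs
  · exact h.measurable_init _ _
  · exact h.measurable_innov _ _ _

lemma IsModelWith.isEdgeChain (h : IsModelWith θ P X ε) (e : Pair p) :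
    IsEdgeChain P (pairSum0 θ e) (pairSum1 θ e) (fun t => X t e.1.1 e.1.2) (driver X ε e) where
  zero_or_one t ω := h.zero_or_one t _ _ ω
  init ω := by simp [driver]
  step t ω := by simpa [driver] using h.step t _ _ ω e.2
  measurable := h.measurable_driver e
  indep := h.indep.precomp (g := fun t : ℕ => (e, t)) fun a b hab => by simpa using hab
  innov_zero t := by simpa [driver] using! h.innov_zero (t + 1) _ _ e.2 (by omega)
  innov_one t := by simpa [driver] using! h.innov_one (t + 1) _ _ e.2 (by omega)
  init_one := h.init_one _ _ e.2

lemma IsModelWith.orbit_driver (h : IsModelWith θ P X ε) (e : Pair p) (t : ℕ) (ω : Ω) :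
    X t e.1.1 e.1.2 ω = orbit (fun t => driver X ε e t ω) t := by
  induction t with
  | zero => simp [orbit, driver]
  | succ t ih => rw [orbit, ← ih]; exact (h.isEdgeChain e).step t ω

/-- Functions of the trajectories of distinct pairs are independent. -/
lemma IsModelWith.iIndepFun_comp (h : IsModelWith θ P X ε) (g : Pair p → (ℕ → ℤ) → ℝ)
    (hg : ∀ e, Measurable (g e)) :
    iIndepFun (fun (e : Pair p) ω => g e (fun t => X t e.1.1 e.1.2 ω)) P := by
  have h1 : iIndepFun (fun (e : Pair p) ω t => driver X ε e t ω) P :=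
    iIndepFun_curry h.measurable_driver h.indep
  have h2 := h1.comp (fun e y => g e (orbit y))
    (fun e => (hg e).comp (measurable_pi_iff.2 measurable_orbit))
  convert h2 using 3 with e ω
  simp only [Function.comp]
  congr 1
  exact funext fun t => h.orbit_driver e t ω

end model

/-! ### The expected Hessian -/

lemma measurable_freq00 (n : ℕ) : Measurable (freq00 n) := by
  unfold freq00
  refine (Finset.measurable_fun_sum _ fun t _ => ?_).div_const _
  have h : ∀ s, Measurable fun x : ℕ → ℤ => (x s : ℝ) := fun s =>
    (measurable_from_top (f := fun z : ℤ => (z : ℝ))).comp (measurable_pi_apply s)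
  exact ((h t).const_sub 1).mul ((h (t + 1)).const_sub 1)

lemma measurable_freq11 (n : ℕ) : Measurable (freq11 n) := by
  unfold freq11
  refine (Finset.measurable_fun_sum _ fun t _ => ?_).div_const _
  have h : ∀ s, Measurable fun x : ℕ → ℤ => (x s : ℝ) := fun s =>
    (measurable_from_top (f := fun z : ℤ => (z : ℝ))).comp (measurable_pi_apply s)
  exact (h t).mul (h (t + 1))

/-- The Hessian is affine in the frequencies, so integration replaces them by their means. -/
lemma integral_totalHess {p : ℕ} {Ω : Type*} [MeasurableSpace Ω] {P : Measure Ω}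
    [IsProbabilityMeasure P] {A B : Ω → Fin p × Fin p → ℝ}
    (hA : ∀ e ∈ pairs p, Integrable (fun ω => A ω e) P)
    (hB : ∀ e ∈ pairs p, Integrable (fun ω => B ω e) P) (θ a b : Param p) :
    ∫ ω, totalHess (A ω) (B ω) θ a b ∂P =
      totalHess (fun e => ∫ ω, A ω e ∂P) (fun e => ∫ ω, B ω e ∂P) θ a b := by
  unfold totalHess edgeHess
  have hi : ∀ e ∈ pairs p, ∀ c d f : ℝ, Integrable (fun ω => c - A ω e * d - B ω e * f) P :=
    fun e he c d f => (((integrable_const c).sub' ((hA e he).mul_const d)).sub'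
      ((hB e he).mul_const f))
  rw [integral_const_mul, integral_finsetSum _ fun e he => hi e he _ _ _]
  congr 1
  refine Finset.sum_congr rfl fun e he => ?_
  rw [integral_sub ((integrable_const _).sub' ((hA e he).mul_const _)) ((hB e he).mul_const _),
    integral_sub (integrable_const _) ((hA e he).mul_const _), integral_mul_const,
    integral_mul_const]
  simp

/-- The quadratic form of the expected Hessian. -/
lemma dotProduct_expV {p n : ℕ} (hn : 1 ≤ n) {θs : Param p} {Ω : Type*} [MeasurableSpace Ω]
    {P : Measure Ω} [IsProbabilityMeasure P] {X : ℕ → Fin p → Fin p → Ω → ℤ}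
    (hX : IsModel θs P X) (θ a : Param p) :
    a ⬝ᵥ (expV n P X θ).mulVec a =
      totalHess (fun e => stat00 (pairSum0 θs e) (pairSum1 θs e))
        (fun e => stat11 (pairSum0 θs e) (pairSum1 θs e)) θ a a := by
  obtain ⟨ε, h⟩ := hX
  have hpair : ∀ e ∈ pairs p, e.1 < e.2 := fun e he => by simpa [pairs] using he
  have hE : ∀ b c : Param p, totalHess (fun e => ∫ ω, freq00 n (fun t => X t e.1 e.2 ω) ∂P)
      (fun e => ∫ ω, freq11 n (fun t => X t e.1 e.2 ω) ∂P) θ b c =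
      totalHess (fun e => stat00 (pairSum0 θs e) (pairSum1 θs e))
        (fun e => stat11 (pairSum0 θs e) (pairSum1 θs e)) θ b c := by
    intro b c
    unfold totalHess
    congr 1
    refine Finset.sum_congr rfl fun e he => ?_
    have e0 := (h.isEdgeChain ⟨e, hpair e he⟩).integral_freq00 hn
    have e1 := (h.isEdgeChain ⟨e, hpair e he⟩).integral_freq11 hn
    dsimp only at e0 e1 ⊢
    rw [e0, e1]
  rw [← sum_sum_mul_totalHess]
  simp only [dotProduct, Matrix.mulVec, Finset.mul_sum]
  refine Finset.sum_congr rfl fun k _ => Finset.sum_congr rfl fun l _ => ?_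
  rw [expV, Matrix.of_apply]
  simp_rw [fun ω => V_apply hn (x := fun t i j => X t i j ω)
    (fun t i j => h.zero_or_one t i j ω) θ k l]
  rw [integral_totalHess (fun e he => (h.isEdgeChain ⟨e, hpair e he⟩).integrable_freq00 n)
    (fun e he => (h.isEdgeChain ⟨e, hpair e he⟩).integrable_freq11 n), hE]
  ring

/-- Lower bound for the smallest eigenvalue of the expected Hessian. -/
lemma dotProduct_expV_ge {Cκ cr : ℝ} (hcr : cr ≤ radiusConst Cκ) {p n : ℕ} (hn : 1 ≤ n)
    (hp : 3 ≤ p) {κ₀ κ₁ : ℝ} {θs : Param p} {Ω : Type*} [MeasurableSpace Ω]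
    {P : Measure Ω} [IsProbabilityMeasure P] {X : ℕ → Fin p → Fin p → Ω → ℤ}
    (hX : IsModel θs P X) {θ : Param p}
    (hθ : θ ∈ ballInf θs (cr * Real.exp (-2 * κ₀ - 4 * κ₁)) ∩ sparseSet p Cκ κ₀ κ₁)
    {a : Param p} (ha : ∑ k, a k ^ 2 = 1) :
    hessConst Cκ / 6 * Real.exp (-2 * κ₀ - 4 * κ₁) ≤ a ⬝ᵥ (expV n P X θ).mulVec a := by
  obtain ⟨hb, hs⟩ := hθ
  obtain ⟨⟨h1, h2⟩, h3⟩ := hs ⟨0, by omega⟩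
  obtain ⟨r1, r2⟩ := radius_bounds (h1.trans h2) ((abs_nonneg _).trans h3) hcr
  have henl : θ ∈ sparseSet p (Cκ + 1) (κ₀ + 1) (κ₁ + 1) := sparseSet_enlarge (by simp) hs
  rw [dotProduct_expV hn hX]
  have key := totalHess_ge (A := fun e => stat00 (pairSum0 θs e) (pairSum1 θs e))
    (B := fun e => stat11 (pairSum0 θs e) (pairSum1 θs e)) henl hb r2 r1
    (fun e => ⟨stat00_nonneg _ _, stat00_le_one _ _⟩)
    (fun e => ⟨stat11_nonneg _ _, stat11_le_one _ _⟩) a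
  refine le_trans ?_ key
  -- The mean frequencies are stationary at `θ*`, so both fluctuation sums vanish; then `p - 2 ≥
  -- p/3` turns `1/2` into `1/6`.
  simp only [sub_self, zero_mul, Finset.sum_const_zero, sub_zero, ha, mul_one]
  have hp' : (3 : ℝ) ≤ p := by exact_mod_cast hp
  have hm : 0 ≤ hessConst Cκ * Real.exp (-2 * κ₀ - 4 * κ₁) := by
    have := hessConst_pos Cκ; positivity
  rw [one_div, ← div_eq_inv_mul, le_div_iff₀ (by linarith)]
  nlinarith

/-! ### Counting integer points in a ball -/

section lattice

lemma sum_Icc_half_pow (m : ℕ) :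
    ∑ z ∈ Finset.Icc (-(m : ℤ)) m, (1 / 2 : ℝ) ^ z.natAbs = 3 - 2 * (1 / 2) ^ m := by
  induction m with
  | zero => norm_num
  | succ m ih =>
    have h : Finset.Icc (-((m + 1 : ℕ) : ℤ)) ((m + 1 : ℕ) : ℤ) =
        insert ((m + 1 : ℕ) : ℤ) (insert (-((m + 1 : ℕ) : ℤ)) (Finset.Icc (-(m : ℤ)) m)) := by
      ext z
      simp only [Finset.mem_Icc, Finset.mem_insert]
      omega
    rw [h, Finset.sum_insert (by simp only [Finset.mem_Icc, Finset.mem_insert]; omega),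
      Finset.sum_insert (by simp only [Finset.mem_Icc]; omega), ih, Int.natAbs_neg, Int.natAbs_natCast]
    ring

/-- The integer vectors of squared length at most `N`. -/
def latticeBall (p N : ℕ) : Finset (Fin p → ℤ) :=
  (Fintype.piFinset fun _ => Finset.Icc (-(N : ℤ)) N).filter fun z => ∑ i, z i ^ 2 ≤ N

lemma natAbs_le_sq (z : ℤ) : (z.natAbs : ℤ) ≤ z ^ 2 := by
  rw [← Int.natAbs_sq]
  have : z.natAbs ≤ z.natAbs ^ 2 := Nat.le_self_pow (by norm_num) _
  exact_mod_cast this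

lemma mem_latticeBall {p N : ℕ} {z : Fin p → ℤ} :
    z ∈ latticeBall p N ↔ ∑ i, z i ^ 2 ≤ N := by
  simp only [latticeBall, Finset.mem_filter, Fintype.mem_piFinset, Finset.mem_Icc,
    and_iff_right_iff_imp]
  intro h i
  have h1 : z i ^ 2 ≤ ∑ i, z i ^ 2 :=
    Finset.single_le_sum (f := fun i => z i ^ 2) (fun i _ => sq_nonneg _) (Finset.mem_univ i)
  have h2 := natAbs_le_sq (z i)
  omega

/-- Exponential weighting: `∑ |z_i| ≤ ∑ z_i² ≤ N` gives each point weight at least `1` under `2^N ∏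
2^{-|z_i|}`, and the total weight factors with one-dimensional sums below `3`. -/
lemma card_latticeBall_le (p N : ℕ) : ((latticeBall p N).card : ℝ) ≤ 2 ^ N * 3 ^ p := by
  have h1 : ∀ z ∈ latticeBall p N, (1 : ℝ) ≤ 2 ^ N * ∏ i, (1 / 2 : ℝ) ^ (z i).natAbs := by
    intro z hz
    have hz' := mem_latticeBall.1 hz
    have h2 : ∑ i, (z i).natAbs ≤ N := by
      have : ∑ i, ((z i).natAbs : ℤ) ≤ N :=
        (Finset.sum_le_sum fun i _ => natAbs_le_sq (z i)).trans hz'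
      exact_mod_cast this
    rw [Finset.prod_pow_eq_pow_sum]
    calc (1 : ℝ) = 2 ^ N * (1 / 2) ^ N := by rw [← mul_pow]; norm_num
      _ ≤ _ := by
        gcongr 2 ^ N * ?_
        exact pow_le_pow_of_le_one (by norm_num) (by norm_num) h2
  calc ((latticeBall p N).card : ℝ) = ∑ z ∈ latticeBall p N, (1 : ℝ) := by simp
    _ ≤ ∑ z ∈ latticeBall p N, 2 ^ N * ∏ i, (1 / 2 : ℝ) ^ (z i).natAbs := Finset.sum_le_sum h1
    _ ≤ ∑ z ∈ Fintype.piFinset fun _ : Fin p => Finset.Icc (-(N : ℤ)) N,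
          2 ^ N * ∏ i, (1 / 2 : ℝ) ^ (z i).natAbs :=
        Finset.sum_le_sum_of_subset_of_nonneg (Finset.filter_subset _ _)
          fun z _ _ => by positivity
    _ = 2 ^ N * ∏ i : Fin p, ∑ z ∈ Finset.Icc (-(N : ℤ)) N, (1 / 2 : ℝ) ^ z.natAbs := by
        rw [← Finset.mul_sum, Finset.prod_univ_sum]
    _ ≤ 2 ^ N * 3 ^ p := by
        rw [Finset.prod_const, Finset.card_univ, Fintype.card_fin, sum_Icc_half_pow]
        gcongr
        · have : (1 / 2 : ℝ) ^ N ≤ 1 := pow_le_one₀ (by norm_num) (by norm_num)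
          linarith
        · have : (0 : ℝ) ≤ (1 / 2 : ℝ) ^ N := by positivity
          linarith

end lattice

/-! ### Quadratic forms controlled on lattice points -/

section offDiagonal

variable {p : ℕ} (ξ : Pair p → ℝ)

/-- The symmetric bilinear form with zero diagonal and coefficients `ξ / 2` off the diagonal. -/
def offDiag (w y : Fin p → ℝ) : ℝ :=
  ∑ e : Pair p, ξ e * ((w e.1.1 * y e.1.2 + w e.1.2 * y e.1.1) / 2)

lemma offDiag_polarization (w y : Fin p → ℝ) :
    4 * offDiag ξ w y = offDiag ξ (w + y) (w + y) - offDiag ξ (w - y) (w - y) := by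
  simp only [offDiag, Finset.mul_sum, ← Finset.sum_sub_distrib, Pi.add_apply, Pi.sub_apply]
  exact Finset.sum_congr rfl fun e _ => by ring

lemma offDiag_sub_offDiag (w y : Fin p → ℝ) :
    offDiag ξ w w - offDiag ξ y y = offDiag ξ ((4 : ℝ) • (w - y)) ((1 / 4 : ℝ) • (w + y)) := by
  simp only [offDiag, ← Finset.sum_sub_distrib, Pi.add_apply, Pi.sub_apply, Pi.smul_apply,
    smul_eq_mul]
  exact Finset.sum_congr rfl fun e _ => by ring

lemma offDiag_smul (c : ℝ) (w : Fin p → ℝ) :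
    offDiag ξ (c • w) (c • w) = c ^ 2 * offDiag ξ w w := by
  simp only [offDiag, Finset.mul_sum, Pi.smul_apply, smul_eq_mul]
  exact Finset.sum_congr rfl fun e _ => by ring

lemma continuous_offDiag : Continuous fun w => offDiag ξ w w := by
  unfold offDiag
  fun_prop

lemma exists_abs_offDiag_max (hp : 1 ≤ p) : ∃ w : Fin p → ℝ, ∑ i, w i ^ 2 = 1 ∧
    ∀ y : Fin p → ℝ, |offDiag ξ y y| ≤ |offDiag ξ w w| * ∑ i, y i ^ 2 := by
  have hc : IsCompact {w : Fin p → ℝ | ∑ i, w i ^ 2 = 1} := by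
    refine Metric.isCompact_of_isClosed_isBounded
      (isClosed_eq (by fun_prop) continuous_const) ?_
    refine (Metric.isBounded_closedBall (x := (0 : Fin p → ℝ)) (r := 1)).subset fun w hw => ?_
    rw [mem_closedBall_zero_iff, pi_norm_le_iff_of_nonneg zero_le_one]
    intro i
    have h1 : w i ^ 2 ≤ ∑ i, w i ^ 2 :=
      Finset.single_le_sum (f := fun i => w i ^ 2) (fun i _ => sq_nonneg _) (Finset.mem_univ i)
    rw [hw.out] at h1
    rw [Real.norm_eq_abs]
    exact abs_le_one_iff_mul_self_le_one.2 (by rwa [← pow_two])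
  have hne : {w : Fin p → ℝ | ∑ i, w i ^ 2 = 1}.Nonempty := by
    refine ⟨Pi.single ⟨0, hp⟩ 1, ?_⟩
    simp [Pi.single_apply]
  obtain ⟨w, hw, hmax⟩ := hc.exists_isMaxOn hne (continuous_offDiag ξ).abs.continuousOn
  refine ⟨w, hw, fun y => ?_⟩
  rcases (Finset.sum_nonneg fun i _ => sq_nonneg (y i) : 0 ≤ ∑ i, y i ^ 2).eq_or_lt with h0 | h0
  · have hy : y = 0 := by
      ext i
      have := (Finset.sum_eq_zero_iff_of_nonneg fun i _ => sq_nonneg (y i)).1 h0.symm i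
        (Finset.mem_univ i)
      simpa using this
    simp [hy, offDiag]
  · set s := Real.sqrt (∑ i, y i ^ 2) with hs
    have hs0 : 0 < s := Real.sqrt_pos.2 h0
    have hs2 : s ^ 2 = ∑ i, y i ^ 2 := Real.sq_sqrt h0.le
    have hmem : (s⁻¹ • y) ∈ {w : Fin p → ℝ | ∑ i, w i ^ 2 = 1} := by
      simp only [Set.mem_ofPred_eq, Pi.smul_apply, smul_eq_mul, mul_pow, ← Finset.mul_sum, ← hs2]
      rw [← mul_pow, inv_mul_cancel₀ hs0.ne', one_pow]
    have hle : |offDiag ξ (s⁻¹ • y) (s⁻¹ • y)| ≤ |offDiag ξ w w| := hmax hmem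
    have hy : y = s • (s⁻¹ • y) := by rw [smul_smul, mul_inv_cancel₀ hs0.ne', one_smul]
    calc |offDiag ξ y y| = s ^ 2 * |offDiag ξ (s⁻¹ • y) (s⁻¹ • y)| := by
          conv_lhs => rw [hy, offDiag_smul, abs_mul, abs_of_nonneg (sq_nonneg s)]
      _ ≤ s ^ 2 * |offDiag ξ w w| := by gcongr
      _ = _ := by rw [hs2, mul_comm]

/-- A bound of the quadratic form on lattice points extends to all vectors. -/
lemma abs_offDiag_le (hp : 1 ≤ p) {M : ℝ}
    (h : ∀ z ∈ latticeBall p (33 * p), |offDiag ξ (fun i => (z i : ℝ)) (fun i => (z i : ℝ))| ≤ M * p)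
    (y : Fin p → ℝ) : |offDiag ξ y y| ≤ M * ∑ i, y i ^ 2 := by
  obtain ⟨w, hw, hmax⟩ := exists_abs_offDiag_max ξ hp
  refine (hmax y).trans ?_
  gcongr
  set S := |offDiag ξ w w| with hS
  have hp' : (0 : ℝ) < p := by exact_mod_cast hp
  set R := 4 * Real.sqrt p with hR
  have hR0 : 0 < R := by positivity
  have hR2 : R ^ 2 = 16 * p := by rw [hR, mul_pow, Real.sq_sqrt hp'.le]; norm_num
  -- Rounding at scale `4√p` costs at most `p · (1/4)/(16p) = 1/64` in squared norm, and puts the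
  -- integer point at squared length at most `16p(2 + 1/32) ≤ 33p`.
  set z : Fin p → ℤ := fun i => round (R * w i) with hz
  set x : Fin p → ℝ := R⁻¹ • fun i => (z i : ℝ) with hx
  have hdiff : ∑ i, (w - x) i ^ 2 ≤ 1 / 64 := by
    have : ∀ i, (w - x) i ^ 2 ≤ (1 / 64) / (p : ℝ) := by
      intro i
      have h1 := abs_sub_round (R * w i)
      have h2 : (w - x) i = R⁻¹ * (R * w i - round (R * w i)) := by
        simp only [hx, hz, Pi.sub_apply, Pi.smul_apply, smul_eq_mul]
        field_simp
      have h3 : (R * w i - round (R * w i)) ^ 2 ≤ (1 / 2) ^ 2 := by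
        rw [← sq_abs]; gcongr
      rw [h2, mul_pow, inv_pow, hR2]
      calc (16 * (p : ℝ))⁻¹ * (R * w i - (round (R * w i) : ℝ)) ^ 2
          ≤ (16 * (p : ℝ))⁻¹ * (1 / 2 : ℝ) ^ 2 := by gcongr
        _ = (1 / 64) / (p : ℝ) := by field_simp; norm_num
    calc ∑ i, (w - x) i ^ 2 ≤ ∑ _i : Fin p, (1 / 64) / (p : ℝ) := Finset.sum_le_sum fun i _ => this i
      _ = 1 / 64 := by simp; field_simp
  have hsumx : ∑ i, x i ^ 2 ≤ 2 + 1 / 32 := by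
    have : ∀ i, x i ^ 2 ≤ 2 * w i ^ 2 + 2 * (w - x) i ^ 2 := fun i => by
      simp only [Pi.sub_apply]; nlinarith [sq_nonneg (2 * w i - x i)]
    have h2 := Finset.sum_le_sum fun i (_ : i ∈ Finset.univ) => this i
    rw [Finset.sum_add_distrib, ← Finset.mul_sum, ← Finset.mul_sum, hw] at h2
    linarith
  have hsumz : ∑ i, z i ^ 2 ≤ ((33 * p : ℕ) : ℤ) := by
    have h1 : ∑ i, (z i : ℝ) ^ 2 = R ^ 2 * ∑ i, x i ^ 2 := by
      rw [Finset.mul_sum]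
      refine Finset.sum_congr rfl fun i _ => ?_
      simp only [hx, Pi.smul_apply, smul_eq_mul]
      field_simp
    have h2 : ∑ i, (z i : ℝ) ^ 2 ≤ 33 * p := by
      rw [h1, hR2]; nlinarith
    exact_mod_cast h2
  have hQx : |offDiag ξ x x| ≤ M / 16 := by
    rw [hx, offDiag_smul, abs_mul, abs_of_nonneg (sq_nonneg _), inv_pow, hR2]
    calc _ ≤ (16 * (p : ℝ))⁻¹ * (M * p) := by gcongr; exact h z (mem_latticeBall.2 hsumz)
      _ = M / 16 := by field_simp
  -- The difference is a bilinear form in the small vector `w - x` and in `w + x`. The factors `4`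
  -- and `1/4` balance their lengths, so polarization bounds it by half of the maximum `S`, which is
  -- then absorbed on the left.
  have hB : |offDiag ξ w w - offDiag ξ x x| ≤ S / 2 := by
    rw [offDiag_sub_offDiag]
    set a := (4 : ℝ) • (w - x) with ha
    set b := (1 / 4 : ℝ) • (w + x) with hb
    have h1 := hmax (a + b)
    have h2 := hmax (a - b)
    have h3 : ∑ i, (a + b) i ^ 2 + ∑ i, (a - b) i ^ 2 ≤ 2 := by
      have : ∀ i, (a + b) i ^ 2 + (a - b) i ^ 2 ≤
          32 * (w - x) i ^ 2 + (1 / 4 * w i ^ 2 + 1 / 4 * x i ^ 2) := fun i => by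
        simp only [ha, hb, Pi.add_apply, Pi.sub_apply, Pi.smul_apply, smul_eq_mul]
        nlinarith [sq_nonneg (w i - x i)]
      rw [← Finset.sum_add_distrib]
      have h4 := Finset.sum_le_sum fun i (_ : i ∈ Finset.univ) => this i
      simp only [Finset.sum_add_distrib, ← Finset.mul_sum, hw] at h4
      rw [Finset.sum_add_distrib]
      linarith
    have h4 : |4 * offDiag ξ a b| ≤ S * 2 := by
      rw [offDiag_polarization]
      calc _ ≤ |offDiag ξ (a + b) (a + b)| + |offDiag ξ (a - b) (a - b)| := abs_sub _ _
        _ ≤ S * (∑ i, (a + b) i ^ 2 + ∑ i, (a - b) i ^ 2) := by rw [mul_add]; exact add_le_add h1 h2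
        _ ≤ S * 2 := by gcongr
    rw [abs_mul, abs_of_pos (by norm_num : (0 : ℝ) < 4)] at h4
    linarith
  have hfin : S ≤ M / 16 + S / 2 := by
    calc S = |offDiag ξ x x + (offDiag ξ w w - offDiag ξ x x)| := by rw [hS]; congr 1; ring
      _ ≤ _ := (abs_add_le _ _).trans (add_le_add hQx hB)
  have hM : 0 ≤ M / 16 := (abs_nonneg _).trans hQx
  linarith

/-- Expanding the square separates node sums, for which a union bound over `p` nodes is enough, from
the off-diagonal form, which needs the lattice. -/
lemma sum_mul_add_sq_eq (w : Fin p → ℝ) :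
    ∑ e : Pair p, ξ e * (w e.1.1 + w e.1.2) ^ 2 =
      ∑ i, w i ^ 2 * (∑ e : Pair p, (if e.1.1 = i ∨ e.1.2 = i then 1 else 0) * ξ e)
        + 2 * offDiag ξ w w := by
  simp only [offDiag, Finset.mul_sum]
  rw [Finset.sum_comm, ← Finset.sum_add_distrib]
  refine Finset.sum_congr rfl fun e _ => ?_
  have h : ∀ i, (if e.1.1 = i ∨ e.1.2 = i then (1 : ℝ) else 0) =
      (if e.1.1 = i then 1 else 0) + if e.1.2 = i then 1 else 0 := by
    intro i
    have := e.2.ne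
    by_cases h1 : e.1.1 = i
    · have : e.1.2 ≠ i := fun h2 => this (h1.trans h2.symm)
      simp [h1, this]
    · simp [h1]
  simp_rw [h, add_mul, mul_add, Finset.sum_add_distrib]
  simp
  ring

end offDiagonal

/-! ### Union bound for the random quadratic form -/

section probability

variable {p : ℕ} {Ω : Type*} [MeasurableSpace Ω] {P : Measure Ω} {ξ : Pair p → Ω → ℝ} {c : ℝ≥0}

lemma measureReal_abs_sum_ge_le [IsProbabilityMeasure P] (hind : iIndepFun ξ P)
    (hsub : ∀ e, HasSubgaussianMGF (ξ e) c P) (k : Pair p → ℝ) {S : ℝ≥0}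
    (hS : ∑ e, k e ^ 2 ≤ S) {τ : ℝ} (hτ : 0 ≤ τ) :
    P.real {ω | τ ≤ |∑ e, k e * ξ e ω|} ≤ 2 * Real.exp (-τ ^ 2 / (2 * (S * c))) := by
  have h1 : HasSubgaussianMGF (fun ω => ∑ e, k e * ξ e ω) (S * c) P := by
    have h := HasSubgaussianMGF.sum_of_iIndepFun (X := fun e ω => k e * ξ e ω)
      (hind.comp (fun e z => k e * z) fun e => by fun_prop) (s := Finset.univ)
      (c := fun e => ‖k e‖₊ ^ 2 * c)
      (fun e _ => hasSubgaussianMGF_mul (hsub e) (le_of_eq (by push_cast; simp)))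
    refine hasSubgaussianMGF_mono h ?_
    rw [← Finset.sum_mul]
    gcongr
    rw [← NNReal.coe_le_coe]
    push_cast
    simpa using hS
  have h2 := h1.measure_ge_le hτ
  have h3 := h1.neg.measure_ge_le hτ
  have hsubset : {ω | τ ≤ |∑ e, k e * ξ e ω|} ⊆ {ω | τ ≤ ∑ e, k e * ξ e ω} ∪
      {ω | τ ≤ (-fun ω => ∑ e, k e * ξ e ω) ω} := by
    intro ω hω
    rcases le_abs.1 hω.out with h | h
    · exact Or.inl h
    · exact Or.inr h
  push_cast at h2 h3
  calc _ ≤ _ := measureReal_mono hsubset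
    _ ≤ _ := measureReal_union_le _ _
    _ ≤ _ := by rw [two_mul]; exact add_le_add h2 h3

/-- A pair containing `i` is determined by its other endpoint. -/
lemma sum_pair_incident_le (i : Fin p) :
    ∑ e : Pair p, (if e.1.1 = i ∨ e.1.2 = i then (1 : ℝ) else 0) ^ 2 ≤ p := by
  have h1 : ∑ e : Pair p, (if e.1.1 = i ∨ e.1.2 = i then (1 : ℝ) else 0) ^ 2 =
      ((Finset.univ.filter fun e : Pair p => e.1.1 = i ∨ e.1.2 = i).card : ℝ) := by
    rw [Finset.card_filter]
    push_cast
    exact Finset.sum_congr rfl fun e _ => by split_ifs <;> simp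
  rw [h1]
  have h2 : (Finset.univ.filter fun e : Pair p => e.1.1 = i ∨ e.1.2 = i).card ≤
      (Finset.univ : Finset (Fin p)).card := by
    refine Finset.card_le_card_of_injOn (fun e => if e.1.1 = i then e.1.2 else e.1.1)
      (fun _ _ => Finset.mem_univ _) ?_
    intro e he f hf hef
    simp only [Finset.coe_filter, Finset.mem_univ, true_and, Set.mem_ofPred_eq] at he hf
    have he2 := e.2
    have hf2 := f.2
    dsimp only at hef
    refine Subtype.ext (Prod.ext ?_ ?_)
    · split_ifs at hef <;> omega
    · split_ifs at hef <;> omega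
  rw [Finset.card_univ, Fintype.card_fin] at h2
  exact_mod_cast h2

lemma sum_pair_sq_mul_sq_le (z : Fin p → ℝ) :
    ∑ e : Pair p, (z e.1.1 * z e.1.2) ^ 2 ≤ (∑ i, z i ^ 2) ^ 2 := by
  rw [pow_two (∑ i, z i ^ 2), Finset.sum_mul_sum, ← Finset.sum_product']
  rw [Finset.univ_product_univ]
  have h : ∑ e : Pair p, (z e.1.1 * z e.1.2) ^ 2 =
      ∑ e ∈ Finset.univ.filter fun e : Fin p × Fin p => e.1 < e.2, (z e.1 ^ 2 * z e.2 ^ 2) := by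
    rw [Finset.sum_subtype (p := fun e : Fin p × Fin p => e.1 < e.2) _ (by simp)]
    exact Finset.sum_congr rfl fun e _ => by ring
  rw [h]
  exact Finset.sum_le_sum_of_subset_of_nonneg (Finset.filter_subset _ _) fun e _ _ => by positivity

/-- With high probability, the random quadratic form `∑ ξ_{ij} (w_i + w_j)²` is small. -/
lemma exists_bad_set [IsProbabilityMeasure P] (hind : iIndepFun ξ P)
    (hsub : ∀ e, HasSubgaussianMGF (ξ e) c P) (hp : 1 ≤ p) {τ : ℝ} (hτ : 0 ≤ τ) :
    ∃ B : Set Ω, P.real B ≤ 2 * p * Real.exp (-(τ ^ 2 * p / (2 * c)))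
        + 2 * 2 ^ (33 * p) * 3 ^ p * Real.exp (-(τ ^ 2 * p ^ 2 / (2178 * c))) ∧
      ∀ ω ∉ B, ∀ w : Fin p → ℝ,
        |∑ e, ξ e ω * (w e.1.1 + w e.1.2) ^ 2| ≤ 3 * τ * p * ∑ i, w i ^ 2 := by
  have hp' : (0 : ℝ) < p := by exact_mod_cast hp
  set D : Fin p → Set Ω := fun i =>
    {ω | τ * p ≤ |∑ e : Pair p, (if e.1.1 = i ∨ e.1.2 = i then 1 else 0) * ξ e ω|} with hD
  set E : (Fin p → ℤ) → Set Ω := fun z =>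
    {ω | τ * p * p ≤ |∑ e : Pair p, ((z e.1.1 : ℝ) * z e.1.2) * ξ e ω|} with hE
  have hDi : ∀ i, P.real (D i) ≤ 2 * Real.exp (-(τ ^ 2 * p / (2 * c))) := by
    intro i
    have h := measureReal_abs_sum_ge_le hind hsub
      (fun e => if e.1.1 = i ∨ e.1.2 = i then 1 else 0) (S := p) (sum_pair_incident_le i)
      (τ := τ * p) (by positivity)
    refine h.trans (le_of_eq ?_)
    congr 2
    push_cast
    rw [show -(τ * (p : ℝ)) ^ 2 = p * -(τ ^ 2 * p) by ring, show 2 * ((p : ℝ) * c) = p * (2 * c) by ring,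
      mul_div_mul_left _ _ hp'.ne', neg_div]
  -- The coefficients `z_i z_j` have squared sum at most `(33p)²`, and `2178 = 2 · 33²`.
  have hEz : ∀ z ∈ latticeBall p (33 * p),
      P.real (E z) ≤ 2 * Real.exp (-(τ ^ 2 * p ^ 2 / (2178 * c))) := by
    intro z hz
    have hz' : ∑ i, (z i : ℝ) ^ 2 ≤ 33 * p := by exact_mod_cast mem_latticeBall.1 hz
    have h := measureReal_abs_sum_ge_le hind hsub (fun e => (z e.1.1 : ℝ) * z e.1.2)
      (S := (33 * p) ^ 2) (by
        push_cast
        refine (sum_pair_sq_mul_sq_le fun i => (z i : ℝ)).trans ?_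
        gcongr) (τ := τ * p * p) (by positivity)
    refine h.trans (le_of_eq ?_)
    congr 2
    push_cast
    rw [show -(τ * (p : ℝ) * p) ^ 2 = (p : ℝ) ^ 2 * -(τ ^ 2 * p ^ 2) by ring,
      show 2 * ((33 * (p : ℝ)) ^ 2 * c) = (p : ℝ) ^ 2 * (2178 * c) by ring,
      mul_div_mul_left _ _ (by positivity), neg_div]
  refine ⟨(⋃ i ∈ (Finset.univ : Finset (Fin p)), D i) ∪ ⋃ z ∈ latticeBall p (33 * p), E z, ?_, ?_⟩
  · refine (measureReal_union_le _ _).trans (add_le_add ?_ ?_)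
    · refine (measureReal_biUnion_finset_le _ _).trans
        ((Finset.sum_le_sum fun i _ => hDi i).trans (le_of_eq ?_))
      simp
      ring
    · refine (measureReal_biUnion_finset_le _ _).trans
        ((Finset.sum_le_sum hEz).trans ?_)
      rw [Finset.sum_const, nsmul_eq_mul]
      calc _ ≤ (2 ^ (33 * p) * 3 ^ p) * (2 * Real.exp (-(τ ^ 2 * p ^ 2 / (2178 * c)))) := by
            gcongr; exact card_latticeBall_le _ _
        _ = _ := by ring
  · intro ω hω w
    simp only [Set.mem_union, Set.mem_iUnion, not_or, not_exists, hD, hE, Set.mem_ofPred_eq, not_le]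
      at hω
    obtain ⟨h1, h2⟩ := hω
    have hoff := abs_offDiag_le (fun e => ξ e ω) hp (M := τ * p) (fun z hz => by
      have := (h2 z hz).le
      rw [offDiag]
      refine le_trans (le_of_eq ?_) this
      congr 1
      exact Finset.sum_congr rfl fun e _ => by ring) w
    rw [sum_mul_add_sq_eq (fun e => ξ e ω) w]
    refine (abs_add_le _ _).trans ?_
    have hdiag : |∑ i, w i ^ 2 *
        (∑ e : Pair p, (if e.1.1 = i ∨ e.1.2 = i then 1 else 0) * ξ e ω)| ≤ τ * p * ∑ i, w i ^ 2 := by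
      refine (Finset.abs_sum_le_sum_abs _ _).trans ?_
      rw [Finset.mul_sum]
      refine Finset.sum_le_sum fun i _ => ?_
      rw [abs_mul, abs_of_nonneg (sq_nonneg (w i)), mul_comm]
      gcongr
      exact (h1 i (Finset.mem_univ i)).le
    rw [abs_mul, abs_of_pos (by norm_num : (0 : ℝ) < 2)]
    linarith

end probability

/-! ### Strict convexity and uniqueness of the minimizer -/

lemma ballInf_eq {p : ℕ} (θs : Param p) (r : ℝ) : ballInf θs r = Metric.closedBall θs r := by
  ext θ; simp [ballInf, dist_eq_norm]

/-- A loss with positive definite Hessian on a ball has a unique minimizer in this ball. -/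
lemma existsUnique_isMinOn_totalLoss {p : ℕ} {A B C : Fin p × Fin p → ℝ} {θs : Param p} {r : ℝ}
    (hr : 0 ≤ r) (hpos : ∀ θ ∈ ballInf θs r, ∀ a : Param p, a ≠ 0 → 0 < totalHess A B θ a a) :
    ∃! θ, θ ∈ ballInf θs r ∧ IsMinOn (totalLoss A B C) (ballInf θs r) θ := by
  rw [ballInf_eq] at *
  obtain ⟨θ, hθ, hmin⟩ := (isCompact_closedBall θs r).exists_isMinOn
    (Metric.nonempty_closedBall.2 hr) (differentiable_totalLoss A B C).continuous.continuousOn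
  refine ⟨θ, ⟨hθ, hmin⟩, fun η ⟨hη, hminη⟩ => ?_⟩
  by_contra hne
  have ha : η - θ ≠ 0 := sub_ne_zero.2 hne
  set a := η - θ with ha_def
  set g : ℝ → ℝ := fun s => totalLoss A B C (θ + s • a) with hg
  have hmem : ∀ s ∈ Set.Icc (0 : ℝ) 1, θ + s • a ∈ Metric.closedBall θs r := fun s hs =>
    (convex_closedBall θs r).add_smul_sub_mem hθ hη hs
  have hd1 : deriv g = fun s => totalGrad A B C (θ + s • a) a :=
    funext fun s => (hasDerivAt_totalLoss A B C θ a s).deriv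
  have hconv : StrictConvexOn ℝ (Set.Icc (0 : ℝ) 1) g := by
    refine strictConvexOn_of_deriv2_pos' (convex_Icc 0 1)
      (fun s _ => (hasDerivAt_totalLoss A B C θ a s).continuousAt.continuousWithinAt) ?_
    intro s hs
    rw [Function.iterate_succ, Function.iterate_one, Function.comp, hd1,
      (hasDerivAt_totalGrad A B C θ a a s).deriv]
    exact hpos _ (hmem s hs) a ha
  -- Two distinct minimizers would have a midpoint, still in the convex ball, with a strictly
  -- smaller loss.
  have h := hconv.2 (Set.left_mem_Icc.2 zero_le_one) (Set.right_mem_Icc.2 zero_le_one) zero_ne_one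
    (show (0 : ℝ) < 1 / 2 by norm_num) (show (0 : ℝ) < 1 / 2 by norm_num) (by norm_num)
  have h0 : g 0 = totalLoss A B C θ := by simp [hg]
  have h1 : g 1 = totalLoss A B C η := by simp [hg, ha_def]
  have hle : totalLoss A B C η ≤ totalLoss A B C θ := hminη hθ
  have hmid : totalLoss A B C θ ≤ g (1 / 2) := hmin (hmem (1 / 2) ⟨by norm_num, by norm_num⟩)
  simp only [smul_eq_mul, mul_zero, mul_one, zero_add, h0, h1] at h
  linarith

lemma sum_pairs_eq {p : ℕ} (g : Fin p × Fin p → ℝ) :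
    ∑ e ∈ pairs p, g e = ∑ e : Pair p, g e.1 :=
  Finset.sum_subtype (p := fun e : Fin p × Fin p => e.1 < e.2) _ (by simp [pairs]) g

/-- The Hessian is positive definite once the fluctuations of the frequencies are small. -/
lemma totalHess_pos {p : ℕ} {Cκ κ₀ κ₁ r τ : ℝ} {θ θs : Param p} {A B : Fin p × Fin p → ℝ}
    (hp : 3 ≤ p) (hτ0 : 0 ≤ τ)
    (hθ : θ ∈ sparseSet p (Cκ + 1) (κ₀ + 1) (κ₁ + 1)) (hr : ‖θ - θs‖ ≤ r) (hr8 : 8 * r ≤ 1)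
    (hrc : 192 * r ≤ hessConst Cκ * Real.exp (-2 * κ₀ - 4 * κ₁))
    (hA : ∀ e, 0 ≤ A e ∧ A e ≤ 1) (hB : ∀ e, 0 ≤ B e ∧ B e ≤ 1)
    (hτ : 54 * τ < hessConst Cκ * Real.exp (-2 * κ₀ - 4 * κ₁))
    (hfA : ∀ w : Fin p → ℝ, |∑ e : Pair p, (A e.1 - stat00 (pairSum0 θs e.1) (pairSum1 θs e.1)) *
      logisticDeriv (pairSum1 θs e.1) * (w e.1.1 + w e.1.2) ^ 2| ≤ 3 * τ * p * ∑ i, w i ^ 2)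
    (hfB : ∀ w : Fin p → ℝ, |∑ e : Pair p, (B e.1 - stat11 (pairSum0 θs e.1) (pairSum1 θs e.1)) *
      logisticDeriv2 (pairSum0 θs e.1) (pairSum1 θs e.1) * (w e.1.1 + w e.1.2) ^ 2|
        ≤ 3 * τ * p * ∑ i, w i ^ 2)
    {a : Param p} (ha : a ≠ 0) : 0 < totalHess A B θ a a := by
  refine lt_of_lt_of_le ?_ (totalHess_ge hθ hr hr8 hrc hA hB a)
  set m := hessConst Cκ * Real.exp (-2 * κ₀ - 4 * κ₁) with hm
  have hp' : (3 : ℝ) ≤ p := by exact_mod_cast hp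
  refine mul_pos (by positivity) ?_
  have ha2 : 0 < ∑ k, a k ^ 2 := by
    obtain ⟨k, hk⟩ := Function.ne_iff.1 ha
    exact Finset.sum_pos' (fun i _ => sq_nonneg _) ⟨k, Finset.mem_univ k, by
      have : a k ≠ 0 := hk
      positivity⟩
  have hsplit : ∑ k, a k ^ 2 = ∑ i, a (Sum.inl i) ^ 2 + ∑ i, a (Sum.inr i) ^ 2 :=
    Fintype.sum_sum_type _
  have hl0 : 0 ≤ ∑ i, a (Sum.inl i) ^ 2 := Finset.sum_nonneg fun i _ => sq_nonneg _
  have h1 := (le_abs_self _).trans (hfA fun i => a (Sum.inr i))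
  have h2 := (le_abs_self _).trans (hfB fun i => a (Sum.inl i) - a (Sum.inr i))
  have h3 : ∑ i, (a (Sum.inl i) - a (Sum.inr i)) ^ 2 ≤ 2 * ∑ k, a k ^ 2 := by
    rw [hsplit, ← Finset.sum_add_distrib, Finset.mul_sum]
    refine Finset.sum_le_sum fun i _ => ?_
    nlinarith [sq_nonneg (a (Sum.inl i) + a (Sum.inr i))]
  rw [sum_pairs_eq, sum_pairs_eq]
  have e1 : ∑ e : Pair p, (A e.1 - stat00 (pairSum0 θs e.1) (pairSum1 θs e.1)) *
      logisticDeriv (pairSum1 θs e.1) * pairSum1 a e.1 ^ 2 ≤ 3 * τ * p * ∑ k, a k ^ 2 := by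
    refine h1.trans ?_
    gcongr
    linarith
  have e2 : ∑ e : Pair p, (B e.1 - stat11 (pairSum0 θs e.1) (pairSum1 θs e.1)) *
      logisticDeriv2 (pairSum0 θs e.1) (pairSum1 θs e.1) * (pairSum0 a e.1 - pairSum1 a e.1) ^ 2
        ≤ 3 * τ * p * (2 * ∑ k, a k ^ 2) := by
    refine le_trans (le_of_eq ?_) (h2.trans (by gcongr))
    refine Finset.sum_congr rfl fun e _ => ?_
    simp only [pairSum0, pairSum1, beta0, beta1]
    ring
  -- The `0 → 0` fluctuation costs `3τp` and the `1 → 1` one `6τp`; since `p - 2 ≥ p/3`, the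
  -- requirement becomes `54τ < m`.
  have e3 : 9 * τ * p < m / 2 * (p - 2) := by nlinarith
  nlinarith [mul_lt_mul_of_pos_right e3 ha2]

/-! ### Asymptotics of the failure probability -/

/-- The bound for the probability of a bad event tends to zero. -/
lemma exists_tail_le (g δ : ℝ) (hg : 0 < g) (hδ : 0 < δ) : ∃ N : ℕ, 1 ≤ N ∧ ∀ m : ℕ, N ≤ m →
    35 ≤ g * (m : ℝ) ^ (1 / 3 : ℝ) ∧
    2 * (2 * m * Real.exp (-(g * (m : ℝ) ^ (1 / 3 : ℝ)))
      + 2 * Real.exp (35 - g * (m : ℝ) ^ (1 / 3 : ℝ))) ≤ δ := by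
  have hy : Filter.Tendsto (fun m : ℕ => (m : ℝ) ^ (1 / 3 : ℝ)) Filter.atTop Filter.atTop :=
    (tendsto_rpow_atTop (by norm_num)).comp tendsto_natCast_atTop_atTop
  have h3 := (tendsto_rpow_mul_exp_neg_mul_atTop_nhds_zero 3 g hg).comp hy
  have h0 := (tendsto_rpow_mul_exp_neg_mul_atTop_nhds_zero 0 g hg).comp hy
  -- In terms of `y = m^{1/3}` the bound is `4y³e^{-gy} + 4e^{35}e^{-gy}`.
  have hlim : Filter.Tendsto (fun m : ℕ => 4 * (((m : ℝ) ^ (1 / 3 : ℝ)) ^ (3 : ℝ)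
      * Real.exp (-g * (m : ℝ) ^ (1 / 3 : ℝ))) + 4 * Real.exp 35 *
        (((m : ℝ) ^ (1 / 3 : ℝ)) ^ (0 : ℝ) * Real.exp (-g * (m : ℝ) ^ (1 / 3 : ℝ))))
      Filter.atTop (nhds (4 * 0 + 4 * Real.exp 35 * 0)) :=
    (h3.const_mul 4).add (h0.const_mul _)
  simp only [mul_zero, add_zero] at hlim
  have hev := ((hlim.eventually_le_const hδ).and
    ((hy.const_mul_atTop hg).eventually_ge_atTop 35)).and (Filter.eventually_ge_atTop 1)
  obtain ⟨N, hN⟩ := Filter.eventually_atTop.1 hev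
  refine ⟨N, (hN N le_rfl).2, fun m hm => ?_⟩
  obtain ⟨⟨h1, h2⟩, _⟩ := hN m hm
  refine ⟨h2, le_trans (le_of_eq ?_) h1⟩
  rw [← Real.rpow_mul m.cast_nonneg, Real.rpow_zero, sub_eq_add_neg 35, Real.exp_add]
  norm_num
  ring

lemma two_pow_mul_three_pow_le (p : ℕ) : (2 : ℝ) ^ (33 * p) * 3 ^ p ≤ Real.exp (p * 35) := by
  have h2 : (2 : ℝ) ≤ Real.exp 1 := by linarith [Real.exp_one_gt_d9]
  have h3 : (3 : ℝ) ≤ Real.exp 1 ^ 2 := by nlinarith [Real.exp_one_gt_d9]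
  rw [Real.exp_nat_mul, pow_mul, ← mul_pow]
  gcongr
  calc (2 : ℝ) ^ 33 * 3 ≤ Real.exp 1 ^ 33 * Real.exp 1 ^ 2 := by gcongr
    _ = Real.exp 35 := by rw [← pow_add, ← Real.exp_nat_mul]; norm_num

/-- The probability bound for the random quadratic form, in terms of `n * p` only. -/
lemma tail_le {n p : ℕ} (hn : 1 ≤ n) (hp : 1 ≤ p) {S τ₀ c : ℝ} (hS : 0 < S) (hc : c < 1 / 6)
    (hG : 35 ≤ τ₀ ^ 2 / (2178 * S) * ((n * p : ℕ) : ℝ) ^ (1 / 3 : ℝ)) :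
    2 * p * Real.exp (-((τ₀ * ((n * p : ℕ) : ℝ) ^ (-2 * c)) ^ 2 * p / (2 * (S / n))))
      + 2 * 2 ^ (33 * p) * 3 ^ p *
        Real.exp (-((τ₀ * ((n * p : ℕ) : ℝ) ^ (-2 * c)) ^ 2 * p ^ 2 / (2178 * (S / n))))
    ≤ 2 * ((n * p : ℕ) : ℝ) * Real.exp (-(τ₀ ^ 2 / (2178 * S) * ((n * p : ℕ) : ℝ) ^ (1 / 3 : ℝ)))
      + 2 * Real.exp (35 - τ₀ ^ 2 / (2178 * S) * ((n * p : ℕ) : ℝ) ^ (1 / 3 : ℝ)) := by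
  set x : ℝ := ((n * p : ℕ) : ℝ) with hx
  have hn' : (1 : ℝ) ≤ n := by exact_mod_cast hn
  have hp' : (1 : ℝ) ≤ p := by exact_mod_cast hp
  have hxnp : x = n * p := by rw [hx]; push_cast; ring
  have hx1 : 1 ≤ x := by rw [hxnp]; nlinarith
  have hx0 : 0 < x := by linarith
  set G := τ₀ ^ 2 / (2178 * S) * x ^ (1 / 3 : ℝ) with hGdef
  have hpow : (τ₀ * x ^ (-2 * c)) ^ 2 * x = τ₀ ^ 2 * x ^ (1 - 4 * c) := by
    rw [mul_pow, ← Real.rpow_natCast (x ^ (-2 * c)), ← Real.rpow_mul hx0.le, mul_assoc]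
    congr 1
    nth_rw 2 [← Real.rpow_one x]
    rw [← Real.rpow_add hx0]
    congr 1
    push_cast
    ring
  -- The only use of `c < 1/6`.
  have hmono : x ^ (1 / 3 : ℝ) ≤ x ^ (1 - 4 * c) :=
    Real.rpow_le_rpow_of_exponent_le hx1 (by linarith)
  have hkey : G ≤ (τ₀ * x ^ (-2 * c)) ^ 2 * x / (2178 * S) := by
    rw [hpow, hGdef, div_mul_eq_mul_div]
    gcongr
  have e1 : G ≤ (τ₀ * x ^ (-2 * c)) ^ 2 * p / (2 * (S / n)) := by
    have : (τ₀ * x ^ (-2 * c)) ^ 2 * p / (2 * (S / n)) = (τ₀ * x ^ (-2 * c)) ^ 2 * x / (2 * S) := by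
      rw [hxnp]; field_simp
    rw [this]
    refine hkey.trans ?_
    gcongr
    norm_num
  have e2 : p * G ≤ (τ₀ * x ^ (-2 * c)) ^ 2 * p ^ 2 / (2178 * (S / n)) := by
    have : (τ₀ * x ^ (-2 * c)) ^ 2 * p ^ 2 / (2178 * (S / n)) =
        p * ((τ₀ * x ^ (-2 * c)) ^ 2 * x / (2178 * S)) := by
      rw [hxnp]; field_simp
    rw [this]
    gcongr
  refine add_le_add ?_ ?_
  · gcongr
    rw [hxnp]; nlinarith
  -- The lattice has at most `e^{35p}` points while the exponent is at least `pG`; as `G ≥ 35`, the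
  -- worst case of `p(35 - G)` is `p = 1`.
  · calc _ ≤ 2 * (Real.exp (p * 35) * Real.exp (-(p * G))) := by
          rw [mul_assoc 2, mul_assoc 2]
          gcongr
          exact two_pow_mul_three_pow_le p
      _ = 2 * Real.exp (p * (35 - G)) := by rw [← Real.exp_add]; congr 2; ring
      _ ≤ _ := by gcongr; nlinarith

/-! ### Existence and uniqueness of the MLE -/

section model

variable {p : ℕ} {θs : Param p} {Ω : Type*} [MeasurableSpace Ω] {P : Measure Ω}
  [IsProbabilityMeasure P] {X : ℕ → Fin p → Fin p → Ω → ℤ}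

/-- The fluctuation of the empirical `0 → 0` frequencies, as coefficients of a quadratic form. -/
lemma exists_bad_set_freq00 (hX : IsModel θs P X) {n : ℕ} (hn : 1 ≤ n) (hp : 1 ≤ p) {K : ℝ≥0}
    (hK : ∀ e : Pair p, 3 * (1 + Real.exp (pairSum1 θs e.1)) ≤ K) {τ : ℝ} (hτ : 0 ≤ τ) :
    ∃ B : Set Ω, P.real B ≤ 2 * p * Real.exp (-(τ ^ 2 * p / (2 * (4 * K ^ 2 / n))))
        + 2 * 2 ^ (33 * p) * 3 ^ p * Real.exp (-(τ ^ 2 * p ^ 2 / (2178 * (4 * K ^ 2 / n)))) ∧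
      ∀ ω ∉ B, ∀ w : Fin p → ℝ, |∑ e : Pair p, (freq00 n (fun t => X t e.1.1 e.1.2 ω)
          - stat00 (pairSum0 θs e.1) (pairSum1 θs e.1)) * logisticDeriv (pairSum1 θs e.1)
          * (w e.1.1 + w e.1.2) ^ 2| ≤ 3 * τ * p * ∑ i, w i ^ 2 := by
  obtain ⟨ε, h⟩ := hX
  have hind := h.iIndepFun_comp (fun e y => (freq00 n y
    - stat00 (pairSum0 θs e.1) (pairSum1 θs e.1)) * logisticDeriv (pairSum1 θs e.1))
    fun e => ((measurable_freq00 n).sub_const _).mul_const _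
  have := exists_bad_set hind (c := 4 * K ^ 2 / n) (fun e => by
    simp_rw [mul_comm _ (logisticDeriv _)]
    refine hasSubgaussianMGF_mul ((h.isEdgeChain e).hasSubgaussianMGF_freq00 (hK e) hn) ?_
    have h1 := logisticDeriv_nonneg (pairSum1 θs e.1)
    have h2 := pow_le_one₀ (n := 2) h1 (logisticDeriv_le_one (pairSum1 θs e.1))
    exact mul_le_of_le_one_left (NNReal.coe_nonneg _) h2) hp hτ
  push_cast at this
  exact this

/-- The fluctuation of the empirical `1 → 1` frequencies, as coefficients of a quadratic form. -/
lemma exists_bad_set_freq11 (hX : IsModel θs P X) {n : ℕ} (hn : 1 ≤ n) (hp : 1 ≤ p) {K : ℝ≥0}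
    (hK : ∀ e : Pair p, 3 * (1 + Real.exp (pairSum1 θs e.1)) ≤ K) {τ : ℝ} (hτ : 0 ≤ τ) :
    ∃ B : Set Ω, P.real B ≤ 2 * p * Real.exp (-(τ ^ 2 * p / (2 * (4 * K ^ 2 / n))))
        + 2 * 2 ^ (33 * p) * 3 ^ p * Real.exp (-(τ ^ 2 * p ^ 2 / (2178 * (4 * K ^ 2 / n)))) ∧
      ∀ ω ∉ B, ∀ w : Fin p → ℝ, |∑ e : Pair p, (freq11 n (fun t => X t e.1.1 e.1.2 ω)
          - stat11 (pairSum0 θs e.1) (pairSum1 θs e.1))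
          * logisticDeriv2 (pairSum0 θs e.1) (pairSum1 θs e.1)
          * (w e.1.1 + w e.1.2) ^ 2| ≤ 3 * τ * p * ∑ i, w i ^ 2 := by
  obtain ⟨ε, h⟩ := hX
  have hind := h.iIndepFun_comp (fun e y => (freq11 n y
    - stat11 (pairSum0 θs e.1) (pairSum1 θs e.1))
      * logisticDeriv2 (pairSum0 θs e.1) (pairSum1 θs e.1))
    fun e => ((measurable_freq11 n).sub_const _).mul_const _
  have := exists_bad_set hind (c := 4 * K ^ 2 / n) (fun e => by
    simp_rw [mul_comm _ (logisticDeriv2 _ _)]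
    refine hasSubgaussianMGF_mul ((h.isEdgeChain e).hasSubgaussianMGF_freq11 (hK e) hn) ?_
    have h1 := logisticDeriv2_nonneg (pairSum0 θs e.1) (pairSum1 θs e.1)
    have h2 := pow_le_one₀ (n := 2) h1 (logisticDeriv2_le_one (pairSum0 θs e.1) (pairSum1 θs e.1))
    exact mul_le_of_le_one_left (NNReal.coe_nonneg _) h2) hp hτ
  push_cast at this
  exact this

/-- Condition (A1) with `β_{i,0} ≤ Cκ` gives `β_{i,1} ≤ K + Cκ`, so the variance proxy does not grow
with `κ₁`. -/
lemma three_mul_one_add_exp_le {K Cκ κ₀ κ₁ : ℝ} (hCκ : 0 < Cκ) (hA1 : CondA1 K θs)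
    (hs : θs ∈ sparseSet p Cκ κ₀ κ₁) (e : Pair p) :
    3 * (1 + Real.exp (pairSum1 θs e.1)) ≤ 3 * (1 + Real.exp (2 * (K + Cκ))) := by
  have h : ∀ i, beta1 θs i ≤ K + Cκ := fun i => by
    have h1 := hA1 i
    have h2 : max (beta0 θs i) 0 ≤ Cκ := max_le (hs i).1.2 hCκ.le
    linarith
  gcongr
  rw [pairSum1]
  linarith [h e.1.1, h e.1.2]

end model

/-- With probability tending to one, the MLE in the ball exists and is unique. -/
lemma probability_existsUnique_mle (K : ℝ) {Cκ : ℝ} (hCκ : 0 < Cκ) {cr : ℝ} (hcr0 : 0 < cr)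
    (hcr : cr ≤ radiusConst Cκ) {c : ℝ} (hc : c < 1 / 6) {δ : ℝ} (hδ : 0 < δ) :
    ∃ N : ℕ, ∀ (n p : ℕ), 2 ≤ n → 3 ≤ p → N ≤ n * p →
      ∀ (κ₀ κ₁ : ℝ) (θs : Param p), CondA1 K θs → θs ∈ sparseSet p Cκ κ₀ κ₁ →
        κ₀ + 2 * κ₁ < c * Real.log ((n : ℝ) * (p : ℝ)) →
      ∀ (Ω : Type*) [MeasurableSpace Ω] (P : Measure Ω) [IsProbabilityMeasure P]
        (X : ℕ → Fin p → Fin p → Ω → ℤ), IsModel θs P X →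
        1 - δ ≤ P.real {ω | ∃! θ : Param p, IsMLEIn n (fun t i j => X t i j ω)
          (ballInf θs (cr * Real.exp (-2 * κ₀ - 4 * κ₁))) θ} := by
  obtain ⟨L, hL⟩ : ∃ L : ℝ≥0, (L : ℝ) = 3 * (1 + Real.exp (2 * (K + Cκ))) :=
    ⟨⟨3 * (1 + Real.exp (2 * (K + Cκ))), by positivity⟩, rfl⟩
  have hS0 : 0 < 4 * (L : ℝ) ^ 2 := by rw [hL]; positivity
  set τ₀ : ℝ := hessConst Cκ / 54 with hτ₀
  have hτ₀pos : 0 < τ₀ := div_pos (hessConst_pos Cκ) (by norm_num)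
  obtain ⟨N, hN1, hN⟩ := exists_tail_le (τ₀ ^ 2 / (2178 * (4 * (L : ℝ) ^ 2))) δ (by positivity) hδ
  refine ⟨N, fun n p hn hp hnp κ₀ κ₁ θs hA1 hs hκ Ω _ P _ X hX => ?_⟩
  obtain ⟨hG, htail⟩ := hN (n * p) hnp
  have hn1 : 1 ≤ n := by omega
  have hp1 : 1 ≤ p := by omega
  set x : ℝ := ((n * p : ℕ) : ℝ) with hx
  have hx0 : 0 < x := by rw [hx]; exact_mod_cast Nat.mul_pos hn1 hp1
  set τ : ℝ := τ₀ * x ^ (-2 * c) with hτ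
  have hτpos : 0 < τ := mul_pos hτ₀pos (Real.rpow_pos_of_pos hx0 _)
  -- The growth condition says exactly that `(np)^{-2c} < e^{-2κ₀-4κ₁}`; `τ₀` was chosen to cancel
  -- the `54`.
  have hτlt : 54 * τ < hessConst Cκ * Real.exp (-2 * κ₀ - 4 * κ₁) := by
    have h1 : x ^ (-2 * c) < Real.exp (-2 * κ₀ - 4 * κ₁) := by
      rw [Real.rpow_def_of_pos hx0]
      apply Real.exp_lt_exp.2
      rw [hx]; push_cast
      linarith
    have h2 := mul_lt_mul_of_pos_left h1 (hessConst_pos Cκ)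
    rw [hτ, hτ₀]
    linarith
  obtain ⟨B₁, hB₁, hgood₁⟩ := exists_bad_set_freq00 hX hn1 hp1 (K := L)
    (fun e => (three_mul_one_add_exp_le hCκ hA1 hs e).trans hL.ge) hτpos.le
  obtain ⟨B₂, hB₂, hgood₂⟩ := exists_bad_set_freq11 hX hn1 hp1 (K := L)
    (fun e => (three_mul_one_add_exp_le hCκ hA1 hs e).trans hL.ge) hτpos.le
  have hbound := tail_le hn1 hp1 hS0 hc hG
  rw [← hx, ← hτ] at hbound
  obtain ⟨ε, hmodel⟩ := hX
  have hbad : P.real (B₁ ∪ B₂) ≤ δ := by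
    refine (measureReal_union_le _ _).trans (le_trans ?_ htail)
    linarith
  obtain ⟨⟨k1, k2⟩, k3⟩ := hs ⟨0, by omega⟩
  obtain ⟨r1, r2⟩ := radius_bounds (k1.trans k2) ((abs_nonneg _).trans k3) hcr
  have hsub : (B₁ ∪ B₂)ᶜ ⊆ {ω | ∃! θ : Param p, IsMLEIn n (fun t i j => X t i j ω)
      (ballInf θs (cr * Real.exp (-2 * κ₀ - 4 * κ₁))) θ} := by
    intro ω hω
    simp only [Set.compl_union, Set.mem_inter_iff, Set.mem_compl_iff] at hω
    have hx01 : ∀ t i j, X t i j ω = 0 ∨ X t i j ω = 1 := fun t i j => hmodel.zero_or_one t i j ω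
    simp only [Set.mem_ofPred_eq, IsMLEIn, negLogLik_eq_totalLoss hn1 hx01]
    refine existsUnique_isMinOn_totalLoss (by positivity) fun θ hθ a ha => ?_
    have hθ1 : ‖θ - θs‖ ≤ 1 := by
      have : ‖θ - θs‖ ≤ cr * Real.exp (-2 * κ₀ - 4 * κ₁) := hθ
      linarith [norm_nonneg (θ - θs)]
    exact totalHess_pos hp hτpos.le (sparseSet_enlarge hθ1 hs) hθ r2 r1
      (fun e => freq00_mem (x := fun t => X t e.1 e.2 ω) fun t => hx01 t e.1 e.2)
      (fun e => freq11_mem (x := fun t => X t e.1 e.2 ω) fun t => hx01 t e.1 e.2) hτlt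
      (hgood₁ ω hω.1) (hgood₂ ω hω.2) ha
  -- Subadditivity replaces the complement rule, so no measurability of the bad sets is needed.
  have hone : (1 : ℝ) ≤ P.real (B₁ ∪ B₂)ᶜ + P.real (B₁ ∪ B₂) := by
    have h := measureReal_union_le (μ := P) (B₁ ∪ B₂)ᶜ (B₁ ∪ B₂)
    rwa [Set.compl_union_self, probReal_univ] at h
  have := measureReal_mono (μ := P) hsub
  linarith

end TWHM
end

theorem corollary1 (K Cκ : ℝ) (hCκ : 0 < Cκ) :
    ∃ c₀ : ℝ, 0 < c₀ ∧ ∃ C : ℝ, 0 < C ∧ ∀ cr : ℝ, 0 < cr → cr ≤ c₀ →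
      -- lower bound for the smallest eigenvalue of the expected Hessian
      (∀ (n p : ℕ), 1 ≤ n → 3 ≤ p → ∀ (κ₀ κ₁ : ℝ) (θs : TWHM.Param p), TWHM.CondA1 K θs →
        ∀ (Ω : Type*) [MeasurableSpace Ω] (P : MeasureTheory.Measure Ω)
          [MeasureTheory.IsProbabilityMeasure P] (X : ℕ → Fin p → Fin p → Ω → ℤ),
          TWHM.IsModel θs P X →
          ∀ θ ∈ TWHM.ballInf θs (cr * Real.exp (-2 * κ₀ - 4 * κ₁)) ∩ TWHM.sparseSet p Cκ κ₀ κ₁,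
            ∀ a : Fin p ⊕ Fin p → ℝ, ∑ k, a k ^ 2 = 1 →
              C * Real.exp (-2 * κ₀ - 4 * κ₁) ≤ a ⬝ᵥ (TWHM.expV n P X θ).mulVec a) ∧
      -- existence and uniqueness of the MLE in the ball, with probability tending to one
      (∀ c : ℝ, 0 < c → c < 1 / 6 → ∀ δ : ℝ, 0 < δ → ∃ N : ℕ,
        ∀ (n p : ℕ), 2 ≤ n → 3 ≤ p → N ≤ n * p →
        ∀ (κ₀ κ₁ : ℝ) (θs : TWHM.Param p), TWHM.CondA1 K θs →
          θs ∈ TWHM.sparseSet p Cκ κ₀ κ₁ → κ₀ + 2 * κ₁ < c * Real.log ((n : ℝ) * (p : ℝ)) →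
        ∀ (Ω : Type*) [MeasurableSpace Ω] (P : MeasureTheory.Measure Ω)
          [MeasureTheory.IsProbabilityMeasure P] (X : ℕ → Fin p → Fin p → Ω → ℤ),
          TWHM.IsModel θs P X →
          1 - δ ≤ P.real {ω | ∃! θ : TWHM.Param p,
            TWHM.IsMLEIn n (fun t i j => X t i j ω)
              (TWHM.ballInf θs (cr * Real.exp (-2 * κ₀ - 4 * κ₁))) θ}) := by
  refine ⟨TWHM.radiusConst Cκ, div_pos (TWHM.hessConst_pos Cκ) (by norm_num),
    TWHM.hessConst Cκ / 6, div_pos (TWHM.hessConst_pos Cκ) (by norm_num),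
    fun cr hcr0 hcr => ⟨?_, ?_⟩⟩
  · intro n p hn hp κ₀ κ₁ θs _ Ω _ P _ X hX θ hθ a ha
    exact TWHM.dotProduct_expV_ge hcr hn hp hX hθ ha
  · intro c _ hc δ hδ
    exact TWHM.probability_existsUnique_mle K hCκ hcr0 hcr hc hδ
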